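/- **Setup.** For complex $x,y,r,s$ let the free fermion six vertex weights be $$W(0,0;0,0)=1,\quad W(1,1;1,1)=\frac{r^{-2}x-y}{s^{-2}y-x},\quad W(1,0;1,0)=\frac{s^{-2}y-r^{-2}x}{s^{-2}y-x},$$ $$W(0,1;0,1)=\frac{y-x}{s^{-2}y-x},\quad W(1,0;0,1)=\frac{x(r^{-2}-1)}{s^{-2}y-x},\quad W(0,1;1,0)=\frac{y(s^{-2}-1)}{s^{-2}y-x},$$ and $W(i_1,j_1;i_2,j_2)=0$ in all other cases, where $i_1,j_1,i_2,j_2\in\{0,1\}$ are the numbers of paths on the bottom, left, top and right edge of a vertex. Let $M,N\ge 1$, let $\mathbf x=(x_1,\dots,x_M)$, $\mathbf r=(r_1,\dots,r_M)$, $\mathbf y=(y_1,y_2,\dots)$, $\mathbf s=(s_1,s_2,\dots)$ be complex variables, and let $\lambda=(\lambda_1\ge\dots\ge\lambda_N\ge 0)$ be a signature. Put $\ell_j=\lambda_j+N-j+1$ for $1\le j\le N$ and $\mathcal S(\lambda)=\{\ell_1,\dots,\ell_N\}$. The function $G_\lambda(\mathbf x;\mathbf y;\mathbf r;\mathbf s)$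 is the partition function (the sum over all path configurations of the product of the vertex weights) of the six vertex model in $\mathbb Z_{\ge1}\times\{1,\dots,M\}$ with the weight $W(i_1,j_1;i_2,j_2\mid x_j;y_i;r_j;s_i)$ at the vertex in column $i$ and row $j$, in which paths enter vertically from the bottom in the columns $1,\dots,N$ and exit vertically at the top in the columns in $\mathcal S(\lambda)$, all other boundary edges (on the left, far to the right, and the remaining ones at the bottom and the top) being empty. Let $d=d(\lambda)$ be the integer with $\lambda_d\ge d$ and $\lambda_{d+1}<d+1$ (that is, the number of $j\in\{1,\dots,N\}$ with $\lambda_j\ge j$), and let $\mu_1<\dots<\mu_d$ be the elements of $\{1,\dots,N\}\setminus\mathcal S(\lambda)$. Let $\mathfrak S_d$ be the group of permutations of $\{1,\dots,d\}$. **Theorem.** Suppose that the parameters are generic in the following sense: all $r_j$ are nonzero; $s_k\ne0$ and $y_k-s_k^2x_j\neq 0$ for $1\le k\le\lambda_1+N$ and $1\le j\le M$; $y_k-s_k^2r_j^{-2}x_j\ne0$ for $1\le k\le N$ and $1\le j\le M$; the $x_j$ are pairwise distinct; and the $r_j^{-2}x_j$ are pairwise distinct. Then $$\begin{aligned} G_\lambda(\mathbf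 x;\mathbf y;\mathbf r;\mathbf s)={}&\prod_{j=1}^M\prod_{k=1}^N\frac{y_k-s_k^2r_j^{-2}x_j}{y_k-s_k^2x_j}\sum_{\substack{\mathcal I,\mathcal J\subseteq\{1,\dots,M\}\\|\mathcal I|=|\mathcal J|=d}}\ \prod_{\substack{i\in\mathcal J^c\\ j\in\mathcal J}}\frac1{x_i-x_j}\prod_{\substack{i,j\in\mathcal J\\ i<j}}\frac1{x_j-x_i}\\ &\times\prod_{\substack{i\in\mathcal I\\1\le j\le M}}(r_i^{-2}x_i-x_j)\prod_{\substack{i\in\mathcal I^c\\ j\in\mathcal J}}(r_i^{-2}x_i-x_j)\prod_{\substack{i\in\mathcal I\\ j\in\mathcal I^c}}\frac1{r_i^{-2}x_i-r_j^{-2}x_j}\prod_{\substack{i,j\in\mathcal I\\ i<j}}\frac1{r_i^{-2}x_i-r_j^{-2}x_j}\\ &\times\sum_{\sigma,\rho\in\mathfrak S_d}\operatorname{sgn}(\sigma\rho)\prod_{h=1}^d\Biggl(\frac{y_{\ell_h}(1-s_{\ell_h}^2)}{y_{\ell_h}-s_{\ell_h}^2x_{j_{\rho(h)}}}\prod_{i=N+1}^{\ell_h-1}\frac{s_i^2(y_i-x_{j_{\rho(h)}})}{y_i-s_i^2x_{j_{\rho(h)}}}\Biggr)\\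 &\times\prod_{m=1}^d\Biggl(\frac{s_{\mu_m}^2}{y_{\mu_m}-s_{\mu_m}^2r_{i_{\sigma(m)}}^{-2}x_{i_{\sigma(m)}}}\prod_{k=\mu_m+1}^N\frac{s_k^2\bigl(r_{i_{\sigma(m)}}^{-2}x_{i_{\sigma(m)}}-y_k\bigr)}{y_k-s_k^2r_{i_{\sigma(m)}}^{-2}x_{i_{\sigma(m)}}}\Biggr), \end{aligned}$$ where $\mathcal I=\{i_1<\dots<i_d\}$, $\mathcal J=\{j_1<\dots<j_d\}$, and $\mathcal I^c,\mathcal J^c$ are the complements in $\{1,\dots,M\}$. If $d(\lambda)>M$, then both sides vanish. -/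

import Mathlib

open scoped BigOperators

namespace FreeFermionSixVertex

noncomputable section

/-- The free fermion six vertex weight `W(i₁, j₁; i₂, j₂ | x; y; r; s)`.  The four Booleans say
whether the bottom (`i₁`), left (`j₁`), top (`i₂`) and right (`j₂`) edge at the vertex is occupied
by a path.  The weight vanishes unless `i₁ + j₁ = i₂ + j₂`. -/
def W (x y r s : ℂ) : Bool → Bool → Bool → Bool → ℂ
  | false, false, false, false => 1
  | true, true, true, true => (r ^ (-2 : ℤ) * x - y) / (s ^ (-2 : ℤ) * y - x)
  | true, false, true, false => (s ^ (-2 : ℤ) * y - r ^ (-2 : ℤ) * x) / (s ^ (-2 : ℤ) * y - x)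
  | false, true, false, true => (y - x) / (s ^ (-2 : ℤ) * y - x)
  | true, false, false, true => x * (r ^ (-2 : ℤ) - 1) / (s ^ (-2 : ℤ) * y - x)
  | false, true, true, false => y * (s ^ (-2 : ℤ) - 1) / (s ^ (-2 : ℤ) * y - x)
  | _, _, _, _ => 0

/-- A path configuration in the half-infinite rectangle `ℤ_{≥1} × {1, …, k}`.
Columns are numbered `1, 2, 3, …`; the row numbered `j + 1` from the bottom is `j : Fin k`.
* `vert j` is the set of the columns whose vertical edge directly above the first `j` rows is
  occupied (so `vert 0` is the bottom boundary and `vert (Fin.last k)` the top boundary);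
* `horiz j` is the set of those `i` such that the horizontal edge of row `j` between columns `i`
  and `i + 1` is occupied; here `i = 0` stands for the left boundary edge, which has to be empty.
The finiteness of `horiz j` says that no path leaves the rectangle far to the right. -/
structure Config (k : ℕ) where
  vert : Fin (k + 1) → Finset ℕ
  horiz : Fin k → Finset ℕ
  vert_pos : ∀ j, 0 ∉ vert j
  left_empty : ∀ j, 0 ∉ horiz j

/-- The weight of the vertex in column `i + 1` and row `j`. The parameters `x, r` are attached to
the rows and `y, s` to the columns. -/
def Config.vertexWeight {k : ℕ} (x r : Fin k → ℂ) (y s : ℕ → ℂ) (c : Config k)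
    (j : Fin k) (i : ℕ) : ℂ :=
  W (x j) (y (i + 1)) (r j) (s (i + 1))
    (decide (i + 1 ∈ c.vert j.castSucc)) (decide (i ∈ c.horiz j))
    (decide (i + 1 ∈ c.vert j.succ)) (decide (i + 1 ∈ c.horiz j))

/-- The weight of a configuration: the product of its vertex weights. All but finitely many of
them are `W(0, 0; 0, 0) = 1`. -/
def Config.weight {k : ℕ} (x r : Fin k → ℂ) (y s : ℕ → ℂ) (c : Config k) : ℂ :=
  ∏ j : Fin k, ∏ᶠ i : ℕ, c.vertexWeight x r y s j i

/-- The partition function of the configurations in which paths enter from the bottom in the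
columns in `bot`, exit at the top in the columns in `top`, and in which all the other boundary
edges are empty. (Only finitely many configurations have a nonzero weight, see
`finite_weight_ne_zero`.) -/
def partitionFunction {k : ℕ} (x r : Fin k → ℂ) (y s : ℕ → ℂ) (bot top : Finset ℕ) : ℂ :=
  ∑ᶠ c ∈ {c : Config k | c.vert 0 = bot ∧ c.vert (Fin.last k) = top}, c.weight x r y s

theorem W_eq_zero (x y r s : ℂ) (i₁ j₁ i₂ j₂ : Bool)
    (h : i₁.toNat + j₁.toNat ≠ i₂.toNat + j₂.toNat) : W x y r s i₁ j₁ i₂ j₂ = 0 := by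
  cases i₁ <;> cases j₁ <;> cases i₂ <;> cases j₂ <;> simp_all [W]

theorem Config.finite_mulSupport {k : ℕ} (x r : Fin k → ℂ) (y s : ℕ → ℂ) (c : Config k)
    (j : Fin k) : (Function.mulSupport (c.vertexWeight x r y s j)).Finite := by
  let T : Finset ℕ := c.vert j.castSucc ∪ c.vert j.succ ∪ c.horiz j
  refine (Finset.finite_toSet (Finset.range (T.sup id + 1))).subset ?_
  intro i hi
  by_contra hlt
  have hle : T.sup id < i := by simpa using hlt
  have hT : ∀ a, i ≤ a → a ∉ T := fun a ha hmem => by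
    have h1 : a ≤ T.sup id := Finset.le_sup (f := id) hmem
    omega
  have h0 := hT i le_rfl
  have h1 := hT (i + 1) (by omega)
  simp only [T, Finset.mem_union, not_or] at h0 h1
  apply hi
  simp [Config.vertexWeight, h0, h1, W]

/-- Path preservation at every vertex of a configuration of nonzero weight. -/
theorem Config.conservation {k : ℕ} {x r : Fin k → ℂ} {y s : ℕ → ℂ} {c : Config k}
    (hc : c.weight x r y s ≠ 0) (j : Fin k) (i : ℕ) :
    (decide (i + 1 ∈ c.vert j.castSucc)).toNat + (decide (i ∈ c.horiz j)).toNat =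
      (decide (i + 1 ∈ c.vert j.succ)).toNat + (decide (i + 1 ∈ c.horiz j)).toNat := by
  by_contra h
  have hz : c.vertexWeight x r y s j i = 0 := W_eq_zero _ _ _ _ _ _ _ _ h
  apply hc
  refine Finset.prod_eq_zero (Finset.mem_univ j) ?_
  rw [finprod_eq_prod _ (c.finite_mulSupport x r y s j)]
  refine Finset.prod_eq_zero (i := i) ?_ hz
  simp [hz]

theorem Config.card_conservation {k : ℕ} {x r : Fin k → ℂ} {y s : ℕ → ℂ} {c : Config k}
    (hc : c.weight x r y s ≠ 0) (j : Fin k) (n : ℕ) :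
    ((c.vert j.castSucc).filter (· ≤ n)).card =
      ((c.vert j.succ).filter (· ≤ n)).card + (decide (n ∈ c.horiz j)).toNat := by
  have step : ∀ (A : Finset ℕ) (n : ℕ), (A.filter (· ≤ n + 1)).card =
      (A.filter (· ≤ n)).card + (decide (n + 1 ∈ A)).toNat := by
    intro A n
    by_cases h : n + 1 ∈ A
    · have : A.filter (· ≤ n + 1) = insert (n + 1) (A.filter (· ≤ n)) := by
        ext a
        simp only [Finset.mem_filter, Finset.mem_insert]
        constructor
        · rintro ⟨h1, h2⟩
          by_cases h3 : a = n + 1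
          · exact Or.inl h3
          · exact Or.inr ⟨h1, by omega⟩
        · rintro (rfl | ⟨h1, h2⟩)
          · exact ⟨h, le_rfl⟩
          · exact ⟨h1, by omega⟩
      rw [this, Finset.card_insert_of_notMem (by simp)]
      simp [h]
    · have : A.filter (· ≤ n + 1) = A.filter (· ≤ n) := by
        ext a
        simp only [Finset.mem_filter]
        constructor
        · rintro ⟨h1, h2⟩
          have h3 : a ≠ n + 1 := fun h3 => h (h3 ▸ h1)
          exact ⟨h1, by omega⟩
        · rintro ⟨h1, h2⟩
          exact ⟨h1, by omega⟩
      rw [this]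
      simp [h]
  have zero : ∀ j, (c.vert j).filter (· ≤ 0) = ∅ := by
    intro j
    ext a
    simp only [Finset.mem_filter, Nat.le_zero, Finset.notMem_empty, iff_false, not_and]
    rintro ha rfl
    exact c.vert_pos j ha
  induction n with
  | zero =>
    rw [zero, zero]
    simp [c.left_empty j]
  | succ n ih =>
    have := Config.conservation hc j n
    rw [step, step]
    omega

theorem Config.vert_bounded {k : ℕ} {x r : Fin k → ℂ} {y s : ℕ → ℂ} {c : Config k}
    (hc : c.weight x r y s ≠ 0) (L : ℕ) (j : Fin k)
    (hL : ∀ a ∈ c.vert j.succ, a ≤ L) :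
    (∀ a ∈ c.vert j.castSucc, a ≤ L) ∧ (∀ a ∈ c.horiz j, a ≤ L) := by
  have hB : ∀ n, L ≤ n → (c.vert j.succ).filter (· ≤ n) = c.vert j.succ := fun n hn =>
    Finset.filter_true_of_mem fun a ha => (hL a ha).trans hn
  let K := (c.vert j.castSucc).sup id + (c.horiz j).sup id + L + 1
  have hA : (c.vert j.castSucc).filter (· ≤ K) = c.vert j.castSucc :=
    Finset.filter_true_of_mem fun a ha => by
      have h1 : a ≤ (c.vert j.castSucc).sup id := Finset.le_sup (f := id) ha
      omega
  have hK : K ∉ c.horiz j := fun h => by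
    have h1 : K ≤ (c.horiz j).sup id := Finset.le_sup (f := id) h
    omega
  have e1 := Config.card_conservation hc j K
  rw [hA, hB K (by omega)] at e1
  simp only [hK, decide_false, Bool.toNat_false, add_zero] at e1
  constructor
  · intro a ha
    by_contra hlt
    have e2 := Config.card_conservation hc j L
    rw [hB L le_rfl] at e2
    have h3 : ((c.vert j.castSucc).filter (· ≤ L)).card < (c.vert j.castSucc).card :=
      Finset.card_lt_card (Finset.filter_ssubset.mpr ⟨a, ha, hlt⟩)
    omega
  · intro a ha
    by_contra hlt
    have e2 := Config.card_conservation hc j a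
    rw [hB a (by omega)] at e2
    have h3 := Finset.card_filter_le (c.vert j.castSucc) (· ≤ a)
    simp only [ha, decide_true, Bool.toNat_true] at e2
    omega

/-- For given boundary data only finitely many configurations have a nonzero weight, so that the
partition function is a finite sum. -/
theorem finite_weight_ne_zero {k : ℕ} (x r : Fin k → ℂ) (y s : ℕ → ℂ) (bot top : Finset ℕ) :
    {c : Config k | (c.vert 0 = bot ∧ c.vert (Fin.last k) = top) ∧
      c.weight x r y s ≠ 0}.Finite := by
  let P : Finset (Finset ℕ) := (Finset.range (top.sup id + 1)).powerset
  let f : Config k → (Fin (k + 1) → Finset ℕ) × (Fin k → Finset ℕ) := fun c => (c.vert, c.horiz)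
  have hf : Function.Injective f := by
    rintro ⟨v, h, _, _⟩ ⟨v', h', _, _⟩ e
    simp only [f, Prod.mk.injEq] at e
    obtain ⟨rfl, rfl⟩ := e
    rfl
  refine Set.Finite.of_finite_image (f := f) ?_ hf.injOn
  refine (Finset.finite_toSet
    ((Fintype.piFinset fun _ : Fin (k + 1) => P) ×ˢ (Fintype.piFinset fun _ : Fin k => P))).subset ?_
  rintro _ ⟨c, ⟨⟨-, htop⟩, hc⟩, rfl⟩
  have hv : ∀ j, ∀ a ∈ c.vert j, a ≤ top.sup id := by
    intro j
    induction j using Fin.reverseInduction with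
    | last =>
      intro a ha
      exact Finset.le_sup (f := id) (htop ▸ ha)
    | cast j ih => exact (Config.vert_bounded hc _ j ih).1
  simp only [f, Finset.coe_product, Set.mem_prod, Finset.mem_coe, Fintype.mem_piFinset, P,
    Finset.mem_powerset]
  refine ⟨fun j a ha => ?_, fun j a ha => ?_⟩
  · exact Finset.mem_range.mpr (Nat.lt_succ_of_le (hv j a ha))
  · exact Finset.mem_range.mpr
      (Nat.lt_succ_of_le ((Config.vert_bounded hc _ j (hv j.succ)).2 a ha))

/-- Nonnegative signatures `λ = (λ₁ ≥ … ≥ λ_N ≥ 0)` with `N` parts; `λ_j` is `parts (j - 1)`. -/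
structure Signature (N : ℕ) where
  parts : Fin N → ℕ
  anti : Antitone parts

namespace Signature

variable {N : ℕ}

/-- The signature `(0, …, 0)`. -/
def zero (N : ℕ) : Signature N := ⟨fun _ => 0, fun _ _ _ => le_rfl⟩

/-- `ℓ_j = λ_j + N - j + 1`; as `j : Fin N` counts from `0`, this reads `λ_j + (N - j)`. -/
def ell (lam : Signature N) (j : Fin N) : ℕ := lam.parts j + (N - j)

/-- The point configuration `𝒮(λ) = {ℓ_1 > … > ℓ_N} ⊆ ℤ_{≥1}`. -/
def pts (lam : Signature N) : Finset ℕ := Finset.univ.image lam.ell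

/-- The number `d(λ)` of those `j ∈ {1, …, N}` with `λ_j ≥ j`. It is the unique `d` with
`λ_d ≥ d` and `λ_{d+1} < d + 1`, see `lt_durfee_iff`. -/
def durfee (lam : Signature N) : ℕ :=
  (Finset.univ.filter fun j : Fin N => (j : ℕ) + 1 ≤ lam.parts j).card

/-- The complement of `𝒮(λ) ∩ {1, …, N}` in `{1, …, N}`. -/
def muSet (lam : Signature N) : Finset ℕ :=
  Finset.Icc 1 N \ (lam.pts ∩ Finset.Icc 1 N)

theorem durfee_le (lam : Signature N) : lam.durfee ≤ N := by
  simpa [durfee] using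
    Finset.card_filter_le (Finset.univ : Finset (Fin N)) (fun j => (j : ℕ) + 1 ≤ lam.parts j)

/-- `λ_j ≥ j` holds exactly for `j = 1, …, d(λ)`. -/
theorem lt_durfee_iff (lam : Signature N) (j : Fin N) :
    (j : ℕ) < lam.durfee ↔ (j : ℕ) + 1 ≤ lam.parts j := by
  constructor
  · intro h
    by_contra hj
    have hsub : (Finset.univ.filter fun i : Fin N => (i : ℕ) + 1 ≤ lam.parts i)
        ⊆ Finset.Iio j := by
      intro i hi
      simp only [Finset.mem_filter, Finset.mem_univ, true_and, Finset.mem_Iio] at hi ⊢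
      by_contra hij
      have h1 := lam.anti (not_lt.mp hij)
      have h2 : (j : ℕ) ≤ i := not_lt.mp hij
      omega
    have := Finset.card_le_card hsub
    rw [Fin.card_Iio] at this
    unfold durfee at h
    omega
  · intro h
    have hsub : Finset.Iic j
        ⊆ Finset.univ.filter fun i : Fin N => (i : ℕ) + 1 ≤ lam.parts i := by
      intro i hi
      simp only [Finset.mem_filter, Finset.mem_univ, true_and, Finset.mem_Iic] at hi ⊢
      have h1 := lam.anti hi
      have h2 : (i : ℕ) ≤ j := hi
      omega
    have := Finset.card_le_card hsub
    rw [Fin.card_Iic] at this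
    unfold durfee
    omega

theorem ell_injective (lam : Signature N) : Function.Injective lam.ell := by
  intro i j h
  unfold ell at h
  have hi := i.2
  have hj := j.2
  rcases lt_trichotomy i j with hij | hij | hij
  · have h1 := lam.anti hij.le
    have h2 : (i : ℕ) < j := hij
    omega
  · exact hij
  · have h1 := lam.anti hij.le
    have h2 : (j : ℕ) < i := hij
    omega

theorem card_muSet (lam : Signature N) : lam.muSet.card = lam.durfee := by
  have h1 : lam.pts ∩ Finset.Icc 1 N =
      (Finset.univ.filter fun j : Fin N => ¬ ((j : ℕ) + 1 ≤ lam.parts j)).image lam.ell := by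
    ext a
    simp only [pts, Finset.mem_inter, Finset.mem_image, Finset.mem_univ, true_and,
      Finset.mem_Icc, Finset.mem_filter]
    constructor
    · rintro ⟨⟨j, rfl⟩, h⟩
      refine ⟨j, ?_, rfl⟩
      have := j.2
      unfold ell at h
      omega
    · rintro ⟨j, h, rfl⟩
      refine ⟨⟨j, rfl⟩, ?_⟩
      have := j.2
      unfold ell
      omega
  have h2 := Finset.card_filter_add_card_filter_not
    (s := (Finset.univ : Finset (Fin N))) (fun j => (j : ℕ) + 1 ≤ lam.parts j)
  have h3 := Finset.card_sdiff_add_card_eq_card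
    (Finset.inter_subset_right : lam.pts ∩ Finset.Icc 1 N ⊆ Finset.Icc 1 N)
  rw [h1, Finset.card_image_of_injective _ lam.ell_injective, ← h1] at h3
  simp only [Finset.card_univ, Fintype.card_fin, Nat.card_Icc] at h2 h3
  unfold muSet durfee
  omega

/-- The elements `μ_1 < … < μ_d` of `{1, …, N} \ (𝒮(λ) ∩ {1, …, N})` in increasing order. -/
def mu (lam : Signature N) (m : Fin lam.durfee) : ℕ :=
  lam.muSet.orderEmbOfFin lam.card_muSet m

/-- `ℓ_h` for `h = 1, …, d`. -/
def ellTop (lam : Signature N) (h : Fin lam.durfee) : ℕ :=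
  lam.ell (Fin.castLE lam.durfee_le h)

end Signature

/-- The function `G_{λ/μ}(x; y; r; s)`, for signatures with the same number of parts. -/
def skewG {M N : ℕ} (lam mu : Signature N) (x : Fin M → ℂ) (y : ℕ → ℂ) (r : Fin M → ℂ)
    (s : ℕ → ℂ) : ℂ :=
  partitionFunction x r y s mu.pts lam.pts

/-- The function `G_λ(x; y; r; s) = G_{λ/(0, …, 0)}(x; y; r; s)`. -/
def G {M N : ℕ} (lam : Signature N) (x : Fin M → ℂ) (y : ℕ → ℂ) (r : Fin M → ℂ)
    (s : ℕ → ℂ) : ℂ :=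
  skewG lam (Signature.zero N) x y r s

/-- The element number `m` (from `0`, in increasing order) of a `d`-element subset. -/
def nth {M d : ℕ} (I : {I : Finset (Fin M) // I.card = d}) (m : Fin d) : Fin M :=
  I.1.orderEmbOfFin I.2 m

end

end FreeFermionSixVertex

open FreeFermionSixVertex

/-! The weights satisfy the free fermion relation, so a row acts on `n` paths as the `n`-th exterior
power of its one-path transfer matrix: the one-row partition function is a minor of `hopMatrix`
(`rowZ_eq_det`, by induction on the columns). By Cauchy–Binet this passes to products of rows
(`prod_rowZ_eq_det`), so `G` is the minor of the product matrix P with rows N, …, 1 and columns ℓ_1,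
…, ℓ_N (`G_eq_det`).

Put u = r⁻²x and q = s⁻²y. Paths never move left, so splitting the columns at N makes each one-path
matrix block upper triangular, with blocks T₁₁, T₁₂, T₂₂. Let A and B be the blocks of P with rows ≤
N and columns ≤ N, respectively > N. The core is the factorization B = A H
(`pathWeight_eq_sum_hookSum`), where H = Σ C_ij β(u_i) ⊗ φ(x_j) is `hookSum` and C is `hookCoeff`.
It follows by induction on the rows from T₁₂ + H_k T₂₂ = T₁₁ H_{k+1} (`hookSum_step`). There T₁₂ is
a multiple of β(x) ⊗ φ(x), the actions of T₁₁ on β(z) and of T₂₂ on φ(z) are given by telescoping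
sums, and the resulting identity for the coefficients C is Lagrange interpolation
(`sum_hookCoeff_succ`).

Consequently the determinant for `G` is det A times a determinant whose columns with ℓ_j ≤ N are
unit vectors. The triangular matrix A gives the prefactor, and the second determinant is, up to
sign, the d × d minor of H with rows μ_m and columns ℓ_1, …, ℓ_d (`det_pathWeight`). Cauchy–Binet
applied twice to H = β C φ produces the sum over I and J (`det_hookSum`), and the minors of C are
evaluated in product form (`det_hookCoeff`). -/

/-! ### Determinant identities: Cauchy–Binet, unit columns, Lagrange products. -/

theorem sign_revPerm_eq (n : ℕ) :
    ((Equiv.Perm.sign (Fin.revPerm : Equiv.Perm (Fin n)) : ℤ) : ℂ) =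
      ∏ c : Fin n, (-1 : ℂ) ^ (c : ℕ) := by
  rw [Equiv.Perm.sign_eq_prod_prod_Iio]
  push_cast
  refine Finset.prod_congr rfl fun j _ => ?_
  have : ∀ i ∈ Finset.Iio j,
      (((if Fin.revPerm i < Fin.revPerm j then (1 : ℤˣ) else -1 : ℤˣ) : ℤ) : ℂ) = -1 := by
    intro i hi
    have hi' : i < j := Finset.mem_Iio.mp hi
    rw [if_neg (by simpa using hi'.le)]
    simp
  rw [Finset.prod_congr rfl this, Finset.prod_const, Fin.card_Iio]

/-- The embedding enumerating an `n`-element set in increasing order. -/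
noncomputable abbrev enum {ι : Type*} [LinearOrder ι] {n : ℕ}
    (I : {I : Finset ι // I.card = n}) : Fin n ↪o ι := I.1.orderEmbOfFin I.2

/-- An injective map factors uniquely as a permutation followed by the increasing enumeration of its
image. -/
theorem sum_injective_eq_sum_perm {ι : Type*} [LinearOrder ι] [Fintype ι] {n : ℕ}
    {R : Type*} [CommRing R] (F : (Fin n → ι) → R)
    (hF : ∀ f, ¬ Function.Injective f → F f = 0) :
    ∑ f, F f = ∑ I : {I : Finset ι // I.card = n}, ∑ σ : Equiv.Perm (Fin n), F (enum I ∘ σ) := by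
  classical
  rw [← Fintype.sum_prod_type']
  symm
  refine Finset.sum_of_injOn (fun p => enum p.1 ∘ p.2) ?_ (by simp) ?_ (fun _ _ => rfl)
  · rintro ⟨I, σ⟩ - ⟨J, τ⟩ - h
    have key : ∀ (K : {I : Finset ι // I.card = n}) (π : Equiv.Perm (Fin n)),
        Set.range (enum K ∘ π) = (K.1 : Set ι) := fun K π => by
      rw [Set.range_comp, π.range_eq_univ, Set.image_univ, Finset.range_orderEmbOfFin]
    have hIJ : I = J := by
      apply Subtype.ext
      apply Finset.coe_injective
      rw [← key I σ, ← key J τ]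
      exact congrArg Set.range h
    subst hIJ
    congr 1
    ext i
    have := congrFun h i
    simp [(enum I).injective this]
  · intro f _ hf
    apply hF
    intro hinj
    apply hf
    have hc : (Finset.univ.image f).card = n := by
      rw [Finset.card_image_of_injective _ hinj]; simp
    let I : {I : Finset ι // I.card = n} := ⟨Finset.univ.image f, hc⟩
    let g : Fin n → Fin n := fun i =>
      (I.1.orderIsoOfFin I.2).symm ⟨f i, by simp [I]⟩
    have hg : Function.Injective g := by
      intro i j h
      have := (I.1.orderIsoOfFin I.2).symm.injective h
      exact hinj (by simpa using this)
    refine ⟨(I, Equiv.ofBijective g (Finite.injective_iff_bijective.mp hg)), by simp, ?_⟩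
    funext i
    simp only [Function.comp, Equiv.ofBijective_apply, enum, ← Finset.coe_orderIsoOfFin_apply, g,
      OrderIso.apply_symm_apply]

/-- The Cauchy–Binet formula. -/
theorem det_mul_cauchyBinet {ι : Type*} [LinearOrder ι] [Fintype ι] {n : ℕ}
    {R : Type*} [CommRing R] (A : Matrix (Fin n) ι R) (B : Matrix ι (Fin n) R) :
    (A * B).det = ∑ I : {I : Finset ι // I.card = n},
      (A.submatrix id (enum I)).det * (B.submatrix (enum I) id).det := by
  classical
  have h1 : (A * B).det = ∑ f : Fin n → ι, (∏ i, A i (f i)) * (B.submatrix f id).det := by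
    have : A * B = Matrix.of fun i => ∑ b : ι, A i b • B b := by
      ext i j
      simp [Matrix.mul_apply]
    rw [this]
    -- Multilinearity in the rows of the product expands the determinant over all maps `f`; a
    -- repeated value gives two equal rows of `B`.
    change Matrix.detRowAlternating (fun i => ∑ b : ι, A i b • B b) = _
    rw [← AlternatingMap.coe_multilinearMap, MultilinearMap.map_sum]
    refine Finset.sum_congr rfl fun f _ => ?_
    rw [MultilinearMap.map_smul_univ]
    rfl
  rw [h1, sum_injective_eq_sum_perm]
  · refine Finset.sum_congr rfl fun I _ => ?_
    rw [← Matrix.det_transpose, Matrix.det_apply', Finset.sum_mul]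
    refine Finset.sum_congr rfl fun σ _ => ?_
    have : B.submatrix (enum I ∘ σ) id = (B.submatrix (enum I) id).submatrix σ id := rfl
    rw [this, Matrix.det_permute]
    simp only [Matrix.transpose_apply, Matrix.submatrix_apply, id, Function.comp]
    ring
  · intro f hf
    simp only [Function.Injective, not_forall] at hf
    obtain ⟨i, j, hij, hne⟩ := hf
    rw [Matrix.det_zero_of_row_eq hne, mul_zero]
    funext k
    simp [hij]


theorem strictAnti_fin_eq_rev {d : ℕ} (g : Fin d → Fin d) (hg : StrictAnti g) : g = Fin.rev := by
  have h : StrictMono (Fin.rev ∘ g) := fun i j hij => Fin.rev_lt_rev.mpr (hg hij)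
  have h2 : Fin.rev ∘ g = id := by
    have hs : Function.Surjective (Fin.rev ∘ g) := Finite.surjective_of_injective h.injective
    exact congrArg DFunLike.coe
      (Subsingleton.elim (StrictMono.orderIsoOfSurjective _ h hs) (OrderIso.refl _))
  funext i
  have := congrFun h2 i
  simp only [Function.comp, id] at this
  rw [← this, Fin.rev_rev, this]

/-- The determinant of a matrix whose columns after the first `d` are distinct unit vectors in
increasing order; `g` lists the remaining rows in decreasing order. -/
theorem det_of_unit_columns_add (d m : ℕ) (X : Matrix (Fin (d + m)) (Fin (d + m)) ℂ)
    (g : Fin d → Fin (d + m)) (e : Fin m → Fin (d + m)) (he : StrictMono e)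
    (hg : StrictAnti g) (hge : ∀ c k, g c ≠ e k)
    (hcov : ∀ i, (∃ c, g c = i) ∨ ∃ k, e k = i)
    (hX : ∀ i k, X i (Fin.natAdd d k) = if i = e k then 1 else 0) :
    X.det = (∏ c : Fin d, (-1 : ℂ) ^ (g c : ℕ)) * (X.submatrix g (Fin.castAdd m)).det := by
  induction m with
  | zero =>
    -- Without unit columns `g` is the reversal, whose sign is the stated product of signs.
    have hg' := strictAnti_fin_eq_rev g hg
    subst hg'
    have h1 : (X.submatrix Fin.rev (Fin.castAdd 0)) = X.submatrix (Fin.revPerm) id := rfl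
    rw [h1, Matrix.det_permute, sign_revPerm_eq, ← mul_assoc]
    have h2 : ∏ c : Fin d, (-1 : ℂ) ^ (Fin.rev c : ℕ) = ∏ c : Fin d, (-1 : ℂ) ^ (c : ℕ) :=
      Equiv.prod_comp Fin.revPerm (fun c : Fin d => (-1 : ℂ) ^ (c : ℕ))
    have h3 : (∏ c : Fin d, (-1 : ℂ) ^ (c : ℕ)) * (∏ c : Fin d, (-1 : ℂ) ^ (c : ℕ)) = 1 := by
      rw [← Finset.prod_mul_distrib]
      refine Finset.prod_eq_one fun c _ => ?_
      rw [← mul_pow]; simp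
    change _ = (∏ c : Fin d, (-1 : ℂ) ^ (Fin.rev c : ℕ)) * _ * _
    rw [h2, h3, one_mul]
  | succ m ih =>
    let p : Fin (d + m + 1) := e (Fin.last m)
    have hgp : ∀ c, g c ≠ p := fun c => hge c _
    have hep : ∀ k : Fin m, e k.castSucc < p := fun k => he (Fin.castSucc_lt_last k)
    choose g' hg' using fun c => Fin.exists_succAbove_eq (hgp c)
    choose e' he' using fun k => Fin.exists_succAbove_eq (hep k).ne
    have hmono := Fin.strictMono_succAbove p
    -- Since `p` is the largest unit row, all d + m - p rows after it are values of `g`. Deleting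
    -- row `p` lowers each of them by one, and these sign changes account for the Laplace sign of
    -- the entry `p` in the last column.
    have hcount : (Finset.univ.filter fun c => p < g c).card = d + m - p := by
      have h1 : (Finset.univ.filter fun c => p < g c).image g = Finset.Ioi p := by
        ext i
        simp only [Finset.mem_image, Finset.mem_filter, Finset.mem_univ, true_and,
          Finset.mem_Ioi]
        constructor
        · rintro ⟨c, h, rfl⟩
          exact h
        · intro hi
          rcases hcov i with ⟨c, rfl⟩ | ⟨k, rfl⟩
          · exact ⟨c, hi, rfl⟩
          · exact absurd hi (not_lt.mpr (he.monotone (Fin.le_last k)))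
      rw [← Finset.card_image_of_injective _ hg.injective, h1, Fin.card_Ioi]
      omega
    have hsign : ∏ c : Fin d, (-1 : ℂ) ^ (g c : ℕ) =
        (∏ c : Fin d, (-1 : ℂ) ^ (g' c : ℕ)) * (-1) ^ (d + m - (p : ℕ)) := by
      have h1 : ∀ c, (-1 : ℂ) ^ (g c : ℕ) =
          (-1 : ℂ) ^ (g' c : ℕ) * if p < g c then -1 else 1 := by
        intro c
        rw [← hg' c]
        rcases lt_or_ge (g' c).castSucc p with h | h
        · rw [Fin.succAbove_of_castSucc_lt _ _ h, if_neg (by exact not_lt.mpr h.le)]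
          simp
        · rw [Fin.succAbove_of_le_castSucc _ _ h,
            if_pos (lt_of_le_of_lt h (Fin.castSucc_lt_succ))]
          simp [pow_succ]
      rw [Finset.prod_congr rfl fun c _ => h1 c, Finset.prod_mul_distrib, ← hcount,
        Finset.prod_ite, Finset.prod_const, Finset.prod_const_one, mul_one]
    have hdet : X.det = (-1) ^ (d + m - (p : ℕ)) *
        (X.submatrix p.succAbove (Fin.castSucc : Fin (d + m) → Fin (d + m + 1))).det := by
      have := Matrix.det_succ_column (n := d + m) X (Fin.last (d + m))
      rw [this, Finset.sum_eq_single p]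
      · have h1 : X p (Fin.last (d + m)) = 1 := by
          have := hX p (Fin.last m)
          rw [if_pos rfl] at this
          exact this
        rw [h1, mul_one, Fin.succAbove_last]
        congr 1
        have hp : (p : ℕ) ≤ d + m := Nat.lt_succ_iff.mp p.2
        have : (p : ℕ) + (Fin.last (d + m) : ℕ) = (d + m - p) + 2 * p := by
          simp; omega
        rw [this, pow_add, pow_mul]
        simp
      · intro i _ hi
        have h1 : X i (Fin.last (d + m)) = 0 := by
          have := hX i (Fin.last m)
          rw [if_neg hi] at this
          exact this
        rw [h1]; simp
      · simp
    rw [hdet, hsign, ih (X.submatrix p.succAbove Fin.castSucc) g' e']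
    · have : (X.submatrix p.succAbove (Fin.castSucc : Fin (d + m) → Fin (d + m + 1))).submatrix g'
          (Fin.castAdd m) = X.submatrix g (Fin.castAdd (m + 1)) := by
        ext i j
        simp only [Matrix.submatrix_apply, hg']
        rfl
      rw [this]; ring
    · intro k l hkl
      rw [← hmono.lt_iff_lt, he', he']
      exact he (by simpa using hkl)
    · intro k l hkl
      rw [← hmono.lt_iff_lt, hg', hg']
      exact hg hkl
    · intro c k h
      apply hge c k.castSucc
      rw [← hg', ← he', h]
    · intro i
      rcases hcov (p.succAbove i) with ⟨c, hc⟩ | ⟨k, hk⟩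
      · exact Or.inl ⟨c, hmono.injective (by rw [hg', hc])⟩
      · right
        have hk2 : k ≠ Fin.last m := by
          rintro rfl
          exact Fin.succAbove_ne p i hk.symm
        obtain ⟨k', rfl⟩ := Fin.exists_castSucc_eq.mpr hk2
        exact ⟨k', hmono.injective (by rw [he', hk])⟩
    · intro i k
      have := hX (p.succAbove i) k.castSucc
      simp only [← he' k] at this
      exact this.trans (if_congr hmono.injective.eq_iff rfl rfl)

theorem det_of_unit_columns {d N : ℕ} (hd : d ≤ N) (X : Matrix (Fin N) (Fin N) ℂ)
    (g : Fin d → Fin N) (e : Fin N → Fin N)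
    (he : ∀ i j : Fin N, d ≤ (i : ℕ) → i < j → e i < e j)
    (hg : StrictAnti g) (hge : ∀ c (k : Fin N), d ≤ (k : ℕ) → g c ≠ e k)
    (hcov : ∀ i, (∃ c, g c = i) ∨ ∃ k : Fin N, d ≤ (k : ℕ) ∧ e k = i)
    (hX : ∀ i (k : Fin N), d ≤ (k : ℕ) → X i k = if i = e k then 1 else 0) :
    X.det = (∏ c : Fin d, (-1 : ℂ) ^ (g c : ℕ)) * (X.submatrix g (Fin.castLE hd)).det := by
  obtain ⟨m, rfl⟩ := Nat.exists_eq_add_of_le hd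
  refine det_of_unit_columns_add d m X g (fun k => e (Fin.natAdd d k)) ?_ hg ?_ ?_ ?_
  · intro k l hkl
    exact he _ _ (by simp) (by simpa using hkl)
  · intro c k
    exact hge c _ (by simp)
  · intro i
    rcases hcov i with h | ⟨k, hk, rfl⟩
    · exact Or.inl h
    · right
      refine ⟨⟨k - d, by omega⟩, ?_⟩
      congr 1
      ext
      simp; omega
  · intro i k
    exact hX i _ (by simp)

/-- `∏_{i<k} (u_k - u_i) (w_i - w_k)` is the determinant of the Lagrange products. -/
theorem det_lagrange_products {n : ℕ} (u w : Fin n → ℂ) (hw : Function.Injective w) :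
    (Matrix.of fun i j => ∏ k ∈ Finset.univ.erase j, (u i - w k)).det =
      (∏ i, ∏ k ∈ Finset.Ioi i, (u k - u i)) * ∏ i, ∏ k ∈ Finset.Ioi i, (w i - w k) := by
  classical
  let p : Fin n → Polynomial ℂ := fun j =>
    ∏ k ∈ Finset.univ.erase j, (Polynomial.X - Polynomial.C (w k))
  have hdeg : ∀ j, (p j).natDegree < n := by
    intro j
    have h1 : (p j).natDegree = (Finset.univ.erase j).card := by
      simp [p, Polynomial.natDegree_prod_of_monic _ _ fun k _ => Polynomial.monic_X_sub_C (w k)]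
    rw [h1, Finset.card_erase_of_mem (Finset.mem_univ j)]
    have := j.pos
    simp; omega
  -- For any nodes `v` the matrix of values is the Vandermonde matrix of `v` times the coefficient
  -- matrix `K`. At v = w it is diagonal, which determines det K without computing it directly.
  let K : Matrix (Fin n) (Fin n) ℂ := Matrix.of fun i j => (p j).coeff i
  have hfac : ∀ v : Fin n → ℂ, (Matrix.of fun i j => ∏ k ∈ Finset.univ.erase j, (v i - w k)) =
      Matrix.vandermonde v * K := by
    intro v
    ext i j
    have : ∏ k ∈ Finset.univ.erase j, (v i - w k) = (p j).eval (v i) := by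
      simp [p, Polynomial.eval_prod]
    rw [Matrix.of_apply, this, Polynomial.eval_eq_sum_range' (hdeg j), Matrix.mul_apply,
      ← Fin.sum_univ_eq_sum_range (fun k => (p j).coeff k * v i ^ k)]
    refine Finset.sum_congr rfl fun k _ => ?_
    simp [Matrix.vandermonde, K, mul_comm]
  have hdiag : (Matrix.of fun i j => ∏ k ∈ Finset.univ.erase j, (w i - w k)) =
      Matrix.diagonal fun j => ∏ k ∈ Finset.univ.erase j, (w j - w k) := by
    ext i j
    by_cases hij : i = j
    · subst hij; simp
    · rw [Matrix.diagonal_apply_ne _ hij, Matrix.of_apply]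
      exact Finset.prod_eq_zero (Finset.mem_erase.mpr ⟨hij, Finset.mem_univ _⟩) (sub_self _)
  have hV : (Matrix.vandermonde w).det ≠ 0 := Matrix.det_vandermonde_ne_zero_iff.mpr hw
  have h1 := congrArg Matrix.det (hfac w)
  rw [hdiag, Matrix.det_diagonal, Matrix.det_mul] at h1
  have hsplit : ∏ j, ∏ k ∈ Finset.univ.erase j, (w j - w k) =
      (∏ i, ∏ k ∈ Finset.Ioi i, (w k - w i)) * ∏ i, ∏ k ∈ Finset.Ioi i, (w i - w k) := by
    have h2 : ∀ j : Fin n, ∏ k ∈ Finset.univ.erase j, (w j - w k) =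
        (∏ k ∈ Finset.Iio j, (w j - w k)) * ∏ k ∈ Finset.Ioi j, (w j - w k) := by
      intro j
      rw [← Finset.prod_union]
      · congr 1
        ext k
        simp [lt_or_lt_iff_ne]
      · rw [Finset.disjoint_left]
        intro k hk hk'
        exact lt_asymm (Finset.mem_Iio.mp hk) (Finset.mem_Ioi.mp hk')
    rw [Finset.prod_congr rfl fun j _ => h2 j, Finset.prod_mul_distrib]
    congr 1
    exact Finset.prod_comm' (by simp)
  rw [hsplit, Matrix.det_vandermonde] at h1
  rw [Matrix.det_vandermonde] at hV
  rw [hfac u, Matrix.det_mul, Matrix.det_vandermonde, mul_left_cancel₀ hV h1.symm]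

theorem det_smul_first_column {m : ℕ} (A B : Matrix (Fin (m + 1)) (Fin (m + 1)) ℂ) (c : ℂ)
    (h0 : ∀ i, A i 0 = c * B i 0) (hs : ∀ i (j : Fin m), A i j.succ = B i j.succ) :
    A.det = c * B.det := by
  rw [Matrix.det_succ_column_zero A, Matrix.det_succ_column_zero B, Finset.mul_sum]
  refine Finset.sum_congr rfl fun i _ => ?_
  have : A.submatrix i.succAbove Fin.succ = B.submatrix i.succAbove Fin.succ := by
    ext k l
    simp [hs]
  rw [this, h0]; ring

theorem det_of_first_row {m : ℕ} (A : Matrix (Fin (m + 1)) (Fin (m + 1)) ℂ)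
    (h : ∀ j : Fin m, A 0 j.succ = 0) :
    A.det = A 0 0 * (A.submatrix Fin.succ Fin.succ).det := by
  rw [Matrix.det_succ_row_zero, Finset.sum_eq_single 0]
  · simp
  · intro j _ hj
    obtain ⟨k, rfl⟩ := Fin.exists_succ_eq.mpr hj
    rw [h]; simp
  · simp

theorem det_of_proportional_columns {m : ℕ} (A : Matrix (Fin (m + 2)) (Fin (m + 2)) ℂ) (c : ℂ)
    (h : ∀ i, A i 1 = c * A i 0) : A.det = 0 := by
  refine Matrix.exists_mulVec_eq_zero_iff.mp ⟨Fin.cons c (Fin.cons (-1) 0), fun h0 => ?_, ?_⟩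
  · have := congrFun h0 1
    rw [← Fin.succ_zero_eq_one] at this
    simp at this
  · funext i
    simp [Matrix.mulVec, dotProduct, Fin.sum_univ_succ, h]
    ring

/-- Below the first row the first two columns are multiples of one column, so both surviving
cofactors are multiples of `B.det`. In `rowZ_eq_det` the resulting scalar is the right-hand side of
the free fermion relation. -/
theorem det_of_first_row_two {m : ℕ} (A : Matrix (Fin (m + 2)) (Fin (m + 2)) ℂ)
    (B : Matrix (Fin (m + 1)) (Fin (m + 1)) ℂ) (β γ : ℂ)
    (h : ∀ j : Fin m, A 0 j.succ.succ = 0)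
    (h0 : ∀ i : Fin (m + 1), A i.succ 0 = β * B i 0)
    (h1 : ∀ i : Fin (m + 1), A i.succ 1 = γ * B i 0)
    (h2 : ∀ (i : Fin (m + 1)) (j : Fin m), A i.succ j.succ.succ = B i j.succ) :
    A.det = (A 0 0 * γ - A 0 1 * β) * B.det := by
  have e1 : (A.submatrix Fin.succ (Fin.succAbove 0)).det = γ * B.det := by
    refine det_smul_first_column _ _ _ (fun i => ?_) fun i j => ?_
    · simpa using h1 i
    · simpa using h2 i j
  have e2 : (A.submatrix Fin.succ (Fin.succAbove 1)).det = β * B.det := by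
    refine det_smul_first_column _ _ _ (fun i => ?_) fun i j => ?_
    · simpa using h0 i
    · have : (1 : Fin (m + 2)).succAbove j.succ = j.succ.succ := by
        rw [← Fin.succ_zero_eq_one, Fin.succ_succAbove_succ]; simp
      simp [this, h2]
  rw [Matrix.det_succ_row_zero, Fin.sum_univ_succ, Fin.sum_univ_succ, Finset.sum_eq_zero]
  · rw [Fin.succ_zero_eq_one, e1, e2]
    simp; ring
  · intro j _
    rw [h]; simp

/-! ### One row: the partition function as a determinant of single-path weights. -/

/-- Column weights satisfying path conservation, normalised by the weight of the empty vertex. -/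
structure IceRule (w : ℕ → Bool → Bool → Bool → Bool → ℂ) : Prop where
  empty : ∀ k, w k false false false false = 1
  conserve : ∀ k i j i' j', i.toNat + j.toNat ≠ i'.toNat + j'.toNat → w k i j i' j' = 0

/-- The one-row partition function of the columns `1, …, n` whose rightmost horizontal edge has
the given occupation. -/
def rowZ (w : ℕ → Bool → Bool → Bool → Bool → ℂ) (S T : Finset ℕ) : ℕ → Bool → ℂ
  | 0, h => if h then 0 else 1
  | n + 1, h => ∑ h' : Bool, rowZ w S T n h' *
      w (n + 1) (decide (n + 1 ∈ S)) h' (decide (n + 1 ∈ T)) h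

/-- The weight of a single path entering a row in column `a` and leaving it in column `b`. -/
def hop (w : ℕ → Bool → Bool → Bool → Bool → ℂ) (a b : ℕ) : ℂ :=
  if a = b then w a true false true false
  else if a < b then w a true false false true *
    (∏ k ∈ Finset.Ioo a b, w k false true false true) * w b false true true false
  else 0

/-- The weight of a single path entering a row in column `a` and crossing the right edge of
column `n`. -/
def exitWeight (w : ℕ → Bool → Bool → Bool → Bool → ℂ) (n a : ℕ) : ℂ :=
  w a true false false true * ∏ k ∈ Finset.Ioc a n, w k false true false true

section

variable {w : ℕ → Bool → Bool → Bool → Bool → ℂ}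

theorem exitWeight_succ {n a : ℕ} (h : a ≤ n) :
    exitWeight w (n + 1) a = w (n + 1) false true false true * exitWeight w n a := by
  unfold exitWeight
  rw [← Finset.insert_Ioc_right_eq_Ioc_add_one h, Finset.prod_insert (by simp)]
  ring

theorem exitWeight_self (n : ℕ) : exitWeight w n n = w n true false false true := by
  simp [exitWeight]

theorem hop_succ {n a : ℕ} (h : a ≤ n) :
    hop w a (n + 1) = w (n + 1) false true true false * exitWeight w n a := by
  unfold hop exitWeight
  rw [if_neg (by omega), if_pos (by omega)]
  have : Finset.Ioo a (n + 1) = Finset.Ioc a n := by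
    ext k; simp only [Finset.mem_Ioo, Finset.mem_Ioc]; omega
  rw [this]; ring

theorem hop_self (n : ℕ) : hop w n n = w n true false true false := by simp [hop]

theorem hop_of_lt {a b : ℕ} (h : b < a) : hop w a b = 0 := by
  unfold hop
  rw [if_neg (by omega), if_neg (by omega)]

theorem top_cases {m L : ℕ} (a : Fin (m + 1) → ℕ) (ha : StrictAnti a)
    (hL : ∀ i, a i ∈ Finset.Icc 1 (L + 1)) :
    (∀ i, a i ∈ Finset.Icc 1 L) ∨ (a 0 = L + 1 ∧ ∀ i : Fin m, a i.succ ∈ Finset.Icc 1 L) := by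
  simp only [Finset.mem_Icc] at *
  by_cases h : a 0 = L + 1
  · right
    refine ⟨h, fun i => ?_⟩
    have := ha (Fin.succ_pos i)
    have := hL i.succ
    omega
  · left
    intro i
    have := ha.antitone (Fin.zero_le i)
    have := hL i
    have := hL 0
    omega

/-- `a` enumerates the elements of `S` in the columns `1, …, L`. -/
def ListsDesc (L : ℕ) (S : Finset ℕ) {m : ℕ} (a : Fin m → ℕ) : Prop :=
  StrictAnti a ∧ (∀ i, a i ∈ Finset.Icc 1 L) ∧ ∀ k ∈ Finset.Icc 1 L, k ∈ S ↔ ∃ i, a i = k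

/-- In decreasing order the new column L + 1 can only be the first entry. The decomposition of the
length is returned as data, because the lengths for `S` and `T` have to be matched afterwards. -/
theorem ListsDesc.step {L : ℕ} {S : Finset ℕ} {m : ℕ} {a : Fin m → ℕ} (h : ListsDesc (L + 1) S a) :
    (ListsDesc L S a ∧ L + 1 ∉ S) ∨
      (∃ (m' : ℕ) (a' : Fin (m' + 1) → ℕ) (e : m = m' + 1), a' ∘ Fin.cast e = a ∧
        ListsDesc L S (a' ∘ Fin.succ) ∧ a' 0 = L + 1 ∧ L + 1 ∈ S) := by
  obtain ⟨h1, h2, h3⟩ := h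
  have low : (∀ i, a i ∈ Finset.Icc 1 L) → (ListsDesc L S a ∧ L + 1 ∉ S) := by
    intro hl
    refine ⟨⟨h1, hl, fun k hk => h3 k ?_⟩, fun hS => ?_⟩
    · simp only [Finset.mem_Icc] at *; omega
    · obtain ⟨i, hi⟩ := (h3 (L + 1) (by simp)).mp hS
      have := hl i
      rw [hi] at this
      simp at this
  cases m with
  | zero => exact Or.inl (low fun i => i.elim0)
  | succ m =>
    rcases top_cases a h1 h2 with hl | ⟨h0, ht⟩
    · exact Or.inl (low hl)
    · right
      refine ⟨m, a, rfl, rfl, ⟨h1.comp_strictMono (Fin.strictMono_succ), ht, fun k hk => ?_⟩, h0,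
        (h3 _ (by simp)).mpr ⟨0, h0⟩⟩
      simp only [Finset.mem_Icc] at hk
      rw [h3 k (by simp; omega), Fin.exists_fin_succ]
      constructor
      · rintro (h | h)
        · omega
        · exact h
      · exact Or.inr

/-- Induction on the number of columns. The case of an occupied right edge has to be carried along;
there the path leaving to the right contributes an additional first column of exit weights. Adding
column L + 1 changes only the first rows and columns, and each of its occupations at bottom and top
becomes an elementary determinant operation. -/
theorem rowZ_eq_det (hw : IceRule w) (L : ℕ)
    (hff : ∀ k ∈ Finset.Icc 1 L, w k true true true true =
      w k true false false true * w k false true true false -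
        w k true false true false * w k false true false true) (S T : Finset ℕ) :
    (∀ (m : ℕ) (a b : Fin m → ℕ), ListsDesc L S a → ListsDesc L T b →
      rowZ w S T L false = (Matrix.of fun i j => hop w (a i) (b j)).det) ∧
    (∀ (m : ℕ) (a : Fin (m + 1) → ℕ) (b : Fin m → ℕ), ListsDesc L S a → ListsDesc L T b →
      rowZ w S T L true = (Matrix.of fun i => (Fin.cons (exitWeight w L (a i))
        fun j => hop w (a i) (b j) : Fin (m + 1) → ℂ)).det) := by
  induction L with
  | zero =>
    constructor
    · intro m a b ha hb
      cases m with
      | zero => simp [rowZ]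
      | succ m => have := ha.2.1 0; simp at this
    · intro m a b ha hb
      have := ha.2.1 0; simp at this
  | succ L ih =>
    obtain ⟨ih0, ih1⟩ := ih fun k hk => hff k (by simp only [Finset.mem_Icc] at *; omega)
    have hffL := hff (L + 1) (by simp)
    have hle : ∀ {m : ℕ} {U : Finset ℕ} {a : Fin m → ℕ}, ListsDesc L U a → ∀ i, a i ≤ L :=
      fun h i => (Finset.mem_Icc.mp (h.2.1 i)).2
    have hz : ∀ i j i' j', i.toNat + j.toNat ≠ i'.toNat + j'.toNat →
      w (L + 1) i j i' j' = 0 := hw.conserve (L + 1)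
    constructor
    · intro m a b ha hb
      rcases ha.step with ⟨ha', hS⟩ | ⟨m', a', rfl, rfl, ha', ha0, hS⟩ <;>
      rcases hb.step with ⟨hb', hT⟩ | ⟨m'', b', e, rfl, hb', hb0, hT⟩
      · simp only [rowZ, hS, hT, Fintype.sum_bool, decide_false]
        rw [hz false true false false (by simp), hw.empty, ih0 m a b ha' hb']
        ring
      · subst e
        simp only [rowZ, hS, hT, Fintype.sum_bool, decide_false, decide_true]
        rw [hz false false true false (by simp), ih1 m'' a (b' ∘ Fin.succ) ha' hb', mul_zero,
          add_zero, mul_comm]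
        symm
        refine det_smul_first_column _ _ _ (fun i => ?_) fun i j => ?_
        · simp [hb0, hop_succ (hle ha' i)]
        · simp
      -- The path entering in column L + 1 has no way out; correspondingly the first row vanishes,
      -- since no path moves left.
      · simp only [rowZ, hS, hT, Fintype.sum_bool, decide_false, decide_true]
        rw [hz true true false false (by simp), hz true false false false (by simp),
          Matrix.det_eq_zero_of_row_eq_zero 0]
        · simp
        · intro j
          have := hle hb' j
          simp only [Matrix.of_apply, Function.comp, Fin.cast_eq_self, ha0]
          exact hop_of_lt (by omega)
      · obtain rfl : m' = m'' := by omega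
        simp only [rowZ, hS, hT, Fintype.sum_bool, decide_true]
        rw [hz true true true false (by simp), ih0 _ _ _ ha' hb', det_of_first_row]
        · simp only [Matrix.of_apply, Function.comp, Fin.cast_eq_self, ha0, hb0, hop_self,
            mul_zero, zero_add, mul_comm]
          rfl
        · intro j
          have := hle hb' j
          simp only [Function.comp] at this
          simp only [Matrix.of_apply, Function.comp, Fin.cast_eq_self, ha0]
          exact hop_of_lt (by omega)
    · intro m a b ha hb
      rcases ha.step with ⟨ha', hS⟩ | ⟨m', a', e', rfl, ha', ha0, hS⟩ <;>
      rcases hb.step with ⟨hb', hT⟩ | ⟨m'', b', rfl, rfl, hb', hb0, hT⟩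
      · simp only [rowZ, hS, hT, Fintype.sum_bool, decide_false]
        rw [hz false false false true (by simp), ih1 _ _ _ ha' hb', mul_zero,
          add_zero, mul_comm]
        symm
        refine det_smul_first_column _ _ _ (fun i => ?_) fun i j => ?_
        · simp [exitWeight_succ (hle ha' i)]
        · simp
      -- Two paths would have to arrive on the same left edge. On the determinant side the exit
      -- column and the column for L + 1 are proportional.
      · simp only [rowZ, hS, hT, Fintype.sum_bool, decide_false, decide_true]
        rw [hz false true true true (by simp), hz false false true true (by simp)]
        have e1 := det_smul_first_column (Matrix.of fun i => (Fin.cons (exitWeight w (L + 1) (a i))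
          fun j => hop w (a i) ((b' ∘ Fin.cast rfl) j) : Fin (m'' + 2) → ℂ))
          (Matrix.of fun i => (Fin.cons (exitWeight w L (a i))
            fun j => hop w (a i) (b' j) : Fin (m'' + 2) → ℂ))
          (w (L + 1) false true false true) (fun i => by simp [exitWeight_succ (hle ha' i)])
          (fun i j => by simp)
        rw [e1, det_of_proportional_columns _ (w (L + 1) false true true false)]
        · simp
        · intro i
          rw [← Fin.succ_zero_eq_one]
          simp [hb0, hop_succ (hle ha' i)]
      · obtain rfl : m = m' := by omega
        simp only [rowZ, hS, hT, Fintype.sum_bool, decide_false, decide_true]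
        rw [hz true true false true (by simp), ih0 _ _ _ ha' hb', det_of_first_row]
        · simp only [Matrix.of_apply, Function.comp, Fin.cast_eq_self, ha0, exitWeight_self,
            mul_zero, zero_add, mul_comm, Fin.cons_zero]
          rfl
        · intro j
          have := hle hb' j
          simp only [Matrix.of_apply, Function.comp, Fin.cast_eq_self, ha0, Fin.cons_succ]
          exact hop_of_lt (by omega)
      -- All four edges at column L + 1 are occupied. This is the only case that needs the free
      -- fermion relation.
      · obtain rfl : m' = m'' + 1 := by omega
        simp only [rowZ, hS, hT, Fintype.sum_bool, decide_true]
        rw [hz true false true true (by simp), ih1 _ _ _ ha' hb', mul_zero, add_zero,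
          det_of_first_row_two _ (Matrix.of fun i =>
            (Fin.cons (exitWeight w L ((a' ∘ Fin.succ) i))
              fun j => hop w ((a' ∘ Fin.succ) i) ((b' ∘ Fin.succ) j) : Fin (m'' + 1) → ℂ))
            (w (L + 1) false true false true) (w (L + 1) false true true false)]
        · rw [mul_comm, hffL]
          congr 2
          · simp [ha0, exitWeight_self]
          · simp only [Matrix.of_apply, ← Fin.succ_zero_eq_one, Fin.cons_succ]
            simp [ha0, hb0, hop_self]
        · intro j
          have := hle hb' j
          simp only [Function.comp] at this
          simp only [Matrix.of_apply, Function.comp, Fin.cast_eq_self, ha0, Fin.cons_succ]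
          exact hop_of_lt (by omega)
        · intro i
          have := hle ha' i
          simp only [Function.comp] at this
          simp [exitWeight_succ this]
        · intro i
          have := hle ha' i
          simp only [Function.comp] at this
          rw [← Fin.succ_zero_eq_one]
          simp [hb0, hop_succ this]
        · intro i j
          simp

end

/-! ### Reduction of the configuration sum to finitely many columns. -/

/-- The column `i + 1`. -/
def col (L : ℕ) : Fin L ↪ ℕ := ⟨fun i => i + 1, fun i j h => by ext; simpa using h⟩

@[simp] theorem col_apply {L : ℕ} (i : Fin L) : col L i = i + 1 := rfl

theorem mem_Icc_of_mem_map_col {L : ℕ} {S : Finset (Fin L)} {a : ℕ} (h : a ∈ S.map (col L)) :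
    a ∈ Finset.Icc 1 L := by
  obtain ⟨i, -, rfl⟩ := Finset.mem_map.mp h
  simp

theorem exists_eq_map_col {L : ℕ} {S : Finset ℕ} (h : S ⊆ Finset.Icc 1 L) :
    ∃ S' : Finset (Fin L), S'.map (col L) = S := by
  have : Finset.Icc 1 L = Finset.univ.map (col L) := by
    ext a
    simp only [Finset.mem_Icc, Finset.mem_map, Finset.mem_univ, true_and, col_apply]
    constructor
    · rintro ⟨h1, h2⟩
      exact ⟨⟨a - 1, by omega⟩, by simp; omega⟩
    · rintro ⟨i, rfl⟩
      omega
  rw [this, Finset.subset_map_iff] at h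
  obtain ⟨u, -, rfl⟩ := h
  exact ⟨u, rfl⟩

theorem sum_map_col {L : ℕ} (f : Finset ℕ → ℂ) :
    ∑ h : Finset (Fin L), f (h.map (col L)) = ∑ h ∈ (Finset.Icc 1 L).powerset, f h := by
  refine Finset.sum_bij (fun h _ => h.map (col L)) ?_ ?_ ?_ (fun _ _ => rfl)
  · intro h _
    exact Finset.mem_powerset.mpr fun a ha => mem_Icc_of_mem_map_col ha
  · intro h _ h' _ e
    exact Finset.map_injective _ e
  · intro h hh
    obtain ⟨S, rfl⟩ := exists_eq_map_col (Finset.mem_powerset.mp hh)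
    exact ⟨S, Finset.mem_univ _, rfl⟩

/-- The weight of the columns `1, …, n` of a row. -/
def rowWeight (w : ℕ → Bool → Bool → Bool → Bool → ℂ) (S T h : Finset ℕ) (n : ℕ) : ℂ :=
  ∏ i ∈ Finset.range n, w (i + 1) (decide (i + 1 ∈ S)) (decide (i ∈ h)) (decide (i + 1 ∈ T))
    (decide (i + 1 ∈ h))

theorem sum_rowWeight (w : ℕ → Bool → Bool → Bool → Bool → ℂ) (S T : Finset ℕ) (n : ℕ) (b : Bool) :
    ∑ h ∈ (Finset.Icc 1 n).powerset, (if decide (n ∈ h) = b then rowWeight w S T h n else 0) =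
      rowZ w S T n b := by
  induction n generalizing b with
  | zero => cases b <;> simp [rowZ, rowWeight]
  | succ n ih =>
    have hins : Finset.Icc 1 (n + 1) = insert (n + 1) (Finset.Icc 1 n) := by
      ext a; simp only [Finset.mem_Icc, Finset.mem_insert]; omega
    have hmem : ∀ h ∈ (Finset.Icc 1 n).powerset, n + 1 ∉ h := by
      intro h hh hn
      have := Finset.mem_powerset.mp hh hn
      simp at this
    -- Whether n + 1 is adjoined to `h` is the occupation `c` of the new right edge; the left edge
    -- of the new column is read off from n ∈ h.
    have key : ∀ c : Bool, ∀ h ∈ (Finset.Icc 1 n).powerset,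
        rowWeight w S T (if c then insert (n + 1) h else h) (n + 1) =
        ∑ h' : Bool, (if decide (n ∈ h) = h' then rowWeight w S T h n else 0) *
          w (n + 1) (decide (n + 1 ∈ S)) h' (decide (n + 1 ∈ T)) c := by
      intro c h hh
      have h1 := hmem h hh
      unfold rowWeight
      rw [Finset.prod_range_succ, Finset.sum_eq_single (decide (n ∈ h))]
      · rw [if_pos rfl]
        congr 1
        · refine Finset.prod_congr rfl fun i hi => ?_
          have hi' := Finset.mem_range.mp hi
          cases c
          · rfl
          · have h2 : i ≠ n + 1 := by omega
            have h3 : i ≠ n := by omega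
            simp [h2, h3]
        · cases c <;> simp [h1]
      · intro b' _ hb'
        rw [if_neg (Ne.symm hb'), zero_mul]
      · simp
    rw [hins, Finset.sum_powerset_insert (by simp)]
    have htot : ∑ h ∈ (Finset.Icc 1 n).powerset,
        rowWeight w S T (if b then insert (n + 1) h else h) (n + 1) = rowZ w S T (n + 1) b := by
      rw [Finset.sum_congr rfl (key b), Finset.sum_comm]
      simp only [rowZ, ← Finset.sum_mul, ih]
    rw [← htot, ← Finset.sum_add_distrib]
    refine Finset.sum_congr rfl fun h hh => ?_
    have h1 := hmem h hh
    cases b <;> simp [h1]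

section

variable {k : ℕ} (x r : Fin k → ℂ) (y s : ℕ → ℂ)

/-- The column weights of row `j`. -/
noncomputable def colW (j : Fin k) (c : ℕ) : Bool → Bool → Bool → Bool → ℂ := W (x j) (y c) (r j) (s c)

theorem iceRule_colW (j : Fin k) : IceRule (colW x r y s j) :=
  ⟨fun _ => rfl, fun _ _ _ _ _ h => W_eq_zero _ _ _ _ _ _ _ _ h⟩

/-- The configuration in the first `L` columns with the given occupied edges. -/
def boundedConfig (L : ℕ) (p : (Fin (k + 1) → Finset (Fin L)) × (Fin k → Finset (Fin L))) :
    Config k where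
  vert j := (p.1 j).map (col L)
  horiz j := (p.2 j).map (col L)
  vert_pos j h := by simpa using mem_Icc_of_mem_map_col h
  left_empty j h := by simpa using mem_Icc_of_mem_map_col h

theorem boundedConfig_injective (L : ℕ) : Function.Injective (boundedConfig (k := k) L) := by
  rintro ⟨v, h⟩ ⟨v', h'⟩ e
  simp only [boundedConfig, Config.mk.injEq] at e
  congr 1
  · funext j
    exact Finset.map_injective _ (congrFun e.1 j)
  · funext j
    exact Finset.map_injective _ (congrFun e.2 j)

theorem finprod_boundedConfig (L : ℕ)
    (p : (Fin (k + 1) → Finset (Fin L)) × (Fin k → Finset (Fin L))) (j : Fin k) :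
    ∏ᶠ i : ℕ, (boundedConfig L p).vertexWeight x r y s j i =
      if decide (L ∈ (p.2 j).map (col L)) = false then
        rowWeight (colW x r y s j) ((p.1 j.castSucc).map (col L)) ((p.1 j.succ).map (col L))
          ((p.2 j).map (col L)) L
      else 0 := by
  have hbig : ∀ (S : Finset (Fin L)) a, L < a → a ∉ S.map (col L) := fun S a ha h => by
    have := Finset.mem_Icc.mp (mem_Icc_of_mem_map_col h)
    omega
  -- One vertex more than the `L` columns: the vertex in column L + 1 can have its left edge
  -- occupied, and conservation then makes its weight zero.
  rw [finprod_eq_prod_of_mulSupport_subset (s := Finset.range (L + 1))]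
  · rw [Finset.prod_range_succ]
    have hlast : (boundedConfig L p).vertexWeight x r y s j L =
        colW x r y s j (L + 1) false (decide (L ∈ (p.2 j).map (col L))) false false := by
      have h1 : ∀ S : Finset (Fin L), decide (L + 1 ∈ S.map (col L)) = false := fun S => by
        simpa using hbig S (L + 1) (by omega)
      change W _ _ _ _ (decide (L + 1 ∈ (p.1 j.castSucc).map (col L))) _
        (decide (L + 1 ∈ (p.1 j.succ).map (col L)))
        (decide (L + 1 ∈ (p.2 j).map (col L))) = _
      rw [h1, h1, h1]
      rfl
    rw [hlast]
    by_cases hL : L ∈ (p.2 j).map (col L)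
    · rw [(iceRule_colW x r y s j).conserve _ _ _ _ _ (by simp [-Finset.mem_map, hL])]
      simp [-Finset.mem_map, hL]
    · rw [decide_eq_false hL, (iceRule_colW x r y s j).empty, mul_one, if_pos rfl]
      rfl
  · intro i hi
    by_contra hlt
    have hle : L < i := by simpa using hlt
    apply hi
    change W _ _ _ _ (decide (i + 1 ∈ (p.1 j.castSucc).map (col L)))
        (decide (i ∈ (p.2 j).map (col L)))
        (decide (i + 1 ∈ (p.1 j.succ).map (col L)))
        (decide (i + 1 ∈ (p.2 j).map (col L))) = _
    rw [decide_eq_false (hbig _ _ (by omega)), decide_eq_false (hbig _ _ (by omega)),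
      decide_eq_false (hbig _ _ (by omega)), decide_eq_false (hbig _ _ (by omega))]
    rfl

theorem vert_le_of_weight_ne_zero {c : Config k} (hc : c.weight x r y s ≠ 0) (L : ℕ)
    (hL : ∀ a ∈ c.vert (Fin.last k), a ≤ L) (j : Fin (k + 1)) : ∀ a ∈ c.vert j, a ≤ L := by
  induction j using Fin.reverseInduction with
  | last => exact hL
  | cast j ih => exact (Config.vert_bounded hc _ j ih).1

/-- Nonzero weight confines a configuration to the columns up to the rightmost exit. With the
vertical edges fixed, the horizontal edges of different rows are independent, so their sum is a
product of one-row partition functions. -/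
theorem partitionFunction_eq_sum (L : ℕ) (B T : Finset (Fin L)) :
    partitionFunction x r y s (B.map (col L)) (T.map (col L)) =
      ∑ v : Fin (k + 1) → Finset (Fin L), if v 0 = B ∧ v (Fin.last k) = T then
        ∏ j : Fin k, rowZ (colW x r y s j) ((v j.castSucc).map (col L))
          ((v j.succ).map (col L)) L false else 0 := by
  classical
  unfold partitionFunction
  rw [finsum_mem_eq_sum_of_inter_support_eq (t := (Finset.univ.filter fun
    p : (Fin (k + 1) → Finset (Fin L)) × (Fin k → Finset (Fin L)) =>
      p.1 0 = B ∧ p.1 (Fin.last k) = T).map ⟨boundedConfig L, boundedConfig_injective L⟩)]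
  · rw [Finset.sum_map, Finset.sum_filter, Fintype.sum_prod_type]
    refine Finset.sum_congr rfl fun v _ => ?_
    by_cases hv : v 0 = B ∧ v (Fin.last k) = T
    · simp only [hv, and_self, if_true]
      have hrow : ∀ j : Fin k, rowZ (colW x r y s j) ((v j.castSucc).map (col L))
          ((v j.succ).map (col L)) L false = ∑ h : Finset (Fin L),
          if decide (L ∈ h.map (col L)) = false then
            rowWeight (colW x r y s j) ((v j.castSucc).map (col L)) ((v j.succ).map (col L))
              (h.map (col L)) L else 0 := by
        intro j
        rw [← sum_rowWeight, sum_map_col (fun h => if decide (L ∈ h) = false then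
          rowWeight (colW x r y s j) ((v j.castSucc).map (col L)) ((v j.succ).map (col L))
              h L else 0)]
      rw [Finset.prod_congr rfl fun j _ => hrow j, Finset.prod_univ_sum, Fintype.piFinset_univ]
      refine Finset.sum_congr rfl fun h _ => ?_
      simp only [Function.Embedding.coeFn_mk, Config.weight]
      exact Finset.prod_congr rfl fun j _ => finprod_boundedConfig x r y s L (v, h) j
    · simp [hv]
  · ext c
    simp only [Set.mem_inter_iff, Set.mem_ofPred_eq, Function.mem_support, Finset.coe_map,
      Function.Embedding.coeFn_mk, Set.mem_image, Finset.coe_filter, Finset.mem_univ, true_and]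
    constructor
    · rintro ⟨⟨hB, hT⟩, hc⟩
      refine ⟨?_, hc⟩
      have hv := vert_le_of_weight_ne_zero x r y s hc L (fun a ha => by
        rw [hT] at ha
        exact (Finset.mem_Icc.mp (mem_Icc_of_mem_map_col ha)).2)
      have hpos : ∀ {U : Finset ℕ}, 0 ∉ U → ∀ a ∈ U, 1 ≤ a := fun h a ha =>
        Nat.one_le_iff_ne_zero.mpr fun h0 => h (h0 ▸ ha)
      choose v hv' using fun j => exists_eq_map_col (L := L) (S := c.vert j) fun a ha =>
        Finset.mem_Icc.mpr ⟨hpos (c.vert_pos j) a ha, hv j a ha⟩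
      choose h hh' using fun j => exists_eq_map_col (L := L) (S := c.horiz j) fun a ha =>
        Finset.mem_Icc.mpr ⟨hpos (c.left_empty j) a ha,
          (Config.vert_bounded hc L j (hv j.succ)).2 a ha⟩
      have hcv : boundedConfig L (v, h) = c := by
        cases c
        simp only [boundedConfig, Config.mk.injEq]
        exact ⟨funext hv', funext hh'⟩
      refine ⟨(v, h), ⟨?_, ?_⟩, hcv⟩
      · exact Finset.map_injective _ ((hv' 0).trans hB)
      · exact Finset.map_injective _ ((hv' _).trans hT)
    · rintro ⟨⟨⟨v, h⟩, ⟨hB, hT⟩, rfl⟩, hc⟩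
      simp only at hB hT
      refine ⟨⟨?_, ?_⟩, hc⟩
      · simp [boundedConfig, hB]
      · simp [boundedConfig, hT]

end

/-! ### Several rows: products of transfer matrices and their minors. -/

theorem rowZ_eq_zero_of_card {w : ℕ → Bool → Bool → Bool → Bool → ℂ} (hw : IceRule w)
    (S T : Finset ℕ) (n : ℕ) (h : Bool)
    (hne : (S ∩ Finset.Icc 1 n).card ≠ (T ∩ Finset.Icc 1 n).card + h.toNat) :
    rowZ w S T n h = 0 := by
  induction n generalizing h with
  | zero =>
    cases h
    · simp at hne
    · simp [rowZ]
  | succ n ih =>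
    have hins : ∀ U : Finset ℕ, (U ∩ Finset.Icc 1 (n + 1)).card =
        (U ∩ Finset.Icc 1 n).card + (decide (n + 1 ∈ U)).toNat := by
      intro U
      have e : Finset.Icc 1 (n + 1) = insert (n + 1) (Finset.Icc 1 n) := by
        ext a; simp only [Finset.mem_Icc, Finset.mem_insert]; omega
      by_cases hU : n + 1 ∈ U
      · rw [e, Finset.inter_insert_of_mem hU, Finset.card_insert_of_notMem (by simp)]
        simp [hU]
      · rw [e, Finset.inter_insert_of_notMem hU]
        simp [hU]
    rw [hins, hins] at hne
    simp only [rowZ]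
    refine Finset.sum_eq_zero fun h' _ => ?_
    by_cases h1 : (S ∩ Finset.Icc 1 n).card = (T ∩ Finset.Icc 1 n).card + h'.toNat
    · rw [hw.conserve, mul_zero]
      omega
    · rw [ih h' h1, zero_mul]

theorem sum_chain_eq_prod {α : Type*} [Fintype α] [DecidableEq α] (k : ℕ)
    (t : Fin k → Matrix α α ℂ) (a b : α) :
    (∑ v : Fin (k + 1) → α, if v 0 = a ∧ v (Fin.last k) = b then
      ∏ j : Fin k, t j (v j.castSucc) (v j.succ) else 0) = (List.ofFn t).prod a b := by
  induction k generalizing b with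
  | zero =>
    rw [← (Equiv.funUnique (Fin 1) α).symm.sum_comp]
    by_cases h : a = b
    · subst h
      simp
    · rw [Finset.sum_eq_zero]
      · simp [h]
      · intro v _
        rw [if_neg]
        rintro ⟨h1, h2⟩
        exact h (h1.symm.trans h2)
  | succ k ih =>
    rw [List.ofFn_succ', List.concat_eq_append, List.prod_append, List.prod_singleton,
      Matrix.mul_apply]
    rw [← (Fin.snocEquiv fun _ : Fin (k + 2) => α).sum_comp, Fintype.sum_prod_type,
      Finset.sum_eq_single b]
    · simp only [Fin.snocEquiv_apply, Fin.snoc_last, and_true]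
      simp only [← ih (fun j => t j.castSucc), Finset.sum_mul]
      rw [Finset.sum_comm]
      refine Finset.sum_congr rfl fun v _ => ?_
      rw [Finset.sum_eq_single (v (Fin.last k))]
      · have h0 : (Fin.snoc (α := fun _ => α) v b : Fin (k + 2) → α) 0 = v 0 := by
          rw [← Fin.castSucc_zero, Fin.snoc_castSucc]
        simp only [h0, and_true, Fin.prod_univ_castSucc, Fin.snoc_castSucc, Fin.succ_last,
          Fin.snoc_last, ← Fin.castSucc_succ, ite_mul, zero_mul]
      · intro c _ hc
        rw [if_neg (fun h => hc h.2.symm), zero_mul]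
      · simp
    · intro c _ hc
      refine Finset.sum_eq_zero fun v _ => ?_
      rw [if_neg]
      rintro ⟨-, h⟩
      simp at h
      exact hc h
    · simp

theorem enum_eq_of_strictAnti {ι : Type*} [LinearOrder ι] {n : ℕ} {a : Fin n → ι}
    (ha : StrictAnti a) (I : {I : Finset ι // I.card = n}) (hI : ∀ i, a i ∈ I.1) :
    (enum I : Fin n → ι) = a ∘ Fin.rev := by
  symm
  exact Finset.orderEmbOfFin_unique I.2 (fun i => hI _)
    (fun i j hij => ha (Fin.rev_lt_rev.mpr hij))

/-- The one-path transfer matrix of a row on the columns `1, …, L`. -/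
def hopMatrix (w : ℕ → Bool → Bool → Bool → Bool → ℂ) (L : ℕ) : Matrix (Fin L) (Fin L) ℂ :=
  Matrix.of fun a b => hop w (a + 1) (b + 1)

theorem det_submatrix_rev {n L : ℕ} (X : Matrix (Fin L) (Fin L) ℂ) (a b : Fin n → Fin L) :
    (X.submatrix (a ∘ Fin.rev) (b ∘ Fin.rev)).det = (X.submatrix a b).det :=
  Matrix.det_submatrix_equiv_self Fin.revPerm (X.submatrix a b)

theorem rowZ_map_col {w : ℕ → Bool → Bool → Bool → Bool → ℂ} (hw : IceRule w) (L : ℕ)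
    (hff : ∀ k ∈ Finset.Icc 1 L, w k true true true true =
      w k true false false true * w k false true true false -
        w k true false true false * w k false true false true) {n : ℕ}
    (S T : {I : Finset (Fin L) // I.card = n}) :
    rowZ w (S.1.map (col L)) (T.1.map (col L)) L false =
      ((hopMatrix w L).submatrix (enum S) (enum T)).det := by
  have hl : ∀ U : {I : Finset (Fin L) // I.card = n},
      ListsDesc L (U.1.map (col L)) (fun i => (enum U (Fin.rev i) : ℕ) + 1) := by
    intro U
    refine ⟨fun i j hij => ?_, fun i => ?_, fun k hk => ?_⟩
    · have : enum U (Fin.rev j) < enum U (Fin.rev i) :=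
        (enum U).strictMono (Fin.rev_lt_rev.mpr hij)
      simpa using this
    · simp
    · simp only [Finset.mem_map, col_apply]
      constructor
      · rintro ⟨a, ha, rfl⟩
        have : a ∈ Set.range (enum U) := by
          rw [Finset.range_orderEmbOfFin]; exact ha
        obtain ⟨i, rfl⟩ := this
        exact ⟨Fin.rev i, by simp⟩
      · rintro ⟨i, rfl⟩
        exact ⟨_, Finset.orderEmbOfFin_mem _ _ _, rfl⟩
  rw [(rowZ_eq_det hw L hff _ _).1 n _ _ (hl S) (hl T), ← det_submatrix_rev]
  rfl

/-- Cauchy–Binet says that taking all `n × n` minors is multiplicative, so the determinant formula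
for one row passes to products. -/
theorem prod_rowZ_eq_det {k L : ℕ} (w : Fin k → ℕ → Bool → Bool → Bool → Bool → ℂ)
    (hw : ∀ j, IceRule (w j))
    (hff : ∀ j, ∀ c ∈ Finset.Icc 1 L, w j c true true true true =
      w j c true false false true * w j c false true true false -
        w j c true false true false * w j c false true false true) {n : ℕ}
    (S T : {I : Finset (Fin L) // I.card = n}) :
    (List.ofFn fun j => (Matrix.of fun S T : Finset (Fin L) =>
      rowZ (w j) (S.map (col L)) (T.map (col L)) L false)).prod S.1 T.1 =
      ((List.ofFn fun j => hopMatrix (w j) L).prod.submatrix (enum S) (enum T)).det := by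
  induction k generalizing T with
  | zero =>
    simp only [List.ofFn_zero, List.prod_nil]
    by_cases h : S = T
    · subst h
      rw [Matrix.one_apply_eq, Matrix.submatrix_one _ (enum S).injective, Matrix.det_one]
    · rw [Matrix.one_apply_ne (fun e => h (Subtype.ext e))]
      symm
      have hns : ¬ S.1 ⊆ T.1 := fun hs =>
        h (Subtype.ext (Finset.eq_of_subset_of_card_le hs (by rw [S.2, T.2])))
      obtain ⟨a, ha, hb⟩ := Finset.not_subset.mp hns
      have : a ∈ Set.range (enum S) := by
        rw [Finset.range_orderEmbOfFin]; exact ha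
      obtain ⟨i, rfl⟩ := this
      refine Matrix.det_eq_zero_of_row_eq_zero i fun j => ?_
      rw [Matrix.submatrix_apply, Matrix.one_apply_ne]
      intro e
      exact hb (e ▸ Finset.orderEmbOfFin_mem _ _ _)
  | succ k ih =>
    rw [List.ofFn_succ', List.ofFn_succ', List.concat_eq_append, List.concat_eq_append,
      List.prod_append, List.prod_append, List.prod_singleton, List.prod_singleton,
      Matrix.mul_apply, Matrix.submatrix_mul _ _ (enum S) id (enum T) Function.bijective_id,
      det_mul_cauchyBinet]
    -- The number of paths is conserved, so only intermediate sets of size `n` occur, as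
    -- Cauchy–Binet requires.
    have hsub : ∀ F : Finset (Fin L) → ℂ, (∀ κ, κ.card ≠ n → F κ = 0) →
        ∑ κ, F κ = ∑ κ : {I : Finset (Fin L) // I.card = n}, F κ.1 := by
      intro F hF
      rw [← Finset.sum_subtype (Finset.univ.filter fun κ : Finset (Fin L) => κ.card = n)
        (by simp) F, Finset.sum_filter_of_ne]
      intro κ _ hκ
      by_contra h
      exact hκ (hF κ h)
    rw [hsub]
    · refine Finset.sum_congr rfl fun κ _ => ?_
      rw [ih _ (fun j => hw _) (fun j => hff _), Matrix.of_apply,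
        rowZ_map_col (hw _) L (hff _)]
      rfl
    · intro κ hκ
      rw [Matrix.of_apply, rowZ_eq_zero_of_card (hw _), mul_zero]
      have : ∀ U : Finset (Fin L), (U.map (col L) ∩ Finset.Icc 1 L).card = U.card := by
        intro U
        rw [Finset.inter_eq_left.mpr (fun a ha => mem_Icc_of_mem_map_col ha), Finset.card_map]
      rw [this, this, T.2]
      simpa using hκ

theorem partitionFunction_eq_det {k L n : ℕ} (x r : Fin k → ℂ) (y s : ℕ → ℂ)
    (hff : ∀ j, ∀ c ∈ Finset.Icc 1 L, colW x r y s j c true true true true =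
      colW x r y s j c true false false true * colW x r y s j c false true true false -
        colW x r y s j c true false true false * colW x r y s j c false true false true)
    (a b : Fin n → Fin L) (ha : StrictAnti a) (hb : StrictAnti b) (B T : Finset ℕ)
    (hB : Finset.univ.image (fun i => (a i : ℕ) + 1) = B)
    (hT : Finset.univ.image (fun i => (b i : ℕ) + 1) = T) :
    partitionFunction x r y s B T =
      ((List.ofFn fun j => hopMatrix (colW x r y s j) L).prod.submatrix a b).det := by
  have key : ∀ c : Fin n → Fin L, StrictAnti c → ∃ I : {I : Finset (Fin L) // I.card = n},
      I.1.map (col L) = Finset.univ.image (fun i => (c i : ℕ) + 1) ∧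
        (enum I : Fin n → Fin L) = c ∘ Fin.rev := by
    intro c hc
    let I : {I : Finset (Fin L) // I.card = n} := ⟨Finset.univ.image c, by
      rw [Finset.card_image_of_injective _ hc.injective]; simp⟩
    refine ⟨I, ?_, enum_eq_of_strictAnti hc I (by simp [I])⟩
    ext m
    simp [I]
  obtain ⟨I, hI, hI'⟩ := key a ha
  obtain ⟨J, hJ, hJ'⟩ := key b hb
  rw [← hB, ← hT, ← hI, ← hJ, partitionFunction_eq_sum,
    ← det_submatrix_rev, ← hI', ← hJ', ← prod_rowZ_eq_det _ (iceRule_colW x r y s) hff,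
    ← sum_chain_eq_prod]
  rfl

/-! ### Lagrange interpolation and the recursion for the hook coefficients. -/

theorem prod_erase_eq_ite {n : ℕ} (f : Fin n → ℂ) (j : Fin n) :
    ∏ m ∈ Finset.univ.erase j, f m = ∏ m, if m = j then 1 else f m := by
  rw [← Finset.filter_ne', Finset.prod_filter]
  refine Finset.prod_congr rfl fun m _ => ?_
  by_cases h : m = j <;> simp [h]

theorem prod_erase_castSucc {n : ℕ} (f : Fin (n + 1) → ℂ) (j : Fin n) :
    ∏ m ∈ Finset.univ.erase j.castSucc, f m =
      (∏ m ∈ Finset.univ.erase j, f m.castSucc) * f (Fin.last n) := by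
  rw [prod_erase_eq_ite, prod_erase_eq_ite, Fin.prod_univ_castSucc]
  have : Fin.last n ≠ j.castSucc := (Fin.castSucc_lt_last j).ne'
  simp [this]

theorem prod_erase_last {n : ℕ} (f : Fin (n + 1) → ℂ) :
    ∏ m ∈ Finset.univ.erase (Fin.last n), f m = ∏ m : Fin n, f m.castSucc := by
  rw [prod_erase_eq_ite, Fin.prod_univ_castSucc]
  have : ∀ m : Fin n, m.castSucc ≠ Fin.last n := fun m => (Fin.castSucc_lt_last m).ne
  simp [this]

theorem eval_eq_sum_lagrange {n : ℕ} (v : Fin n → ℂ) (hv : Function.Injective v)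
    (p : Polynomial ℂ) (hp : p.degree < n) (z : ℂ) :
    p.eval z = ∑ j, p.eval (v j) * ∏ m ∈ Finset.univ.erase j, ((z - v m) / (v j - v m)) := by
  have h := Lagrange.eq_interpolate (s := Finset.univ) (v := v) hv.injOn
    (f := p) (by simpa using hp)
  conv_lhs => rw [h]
  rw [Lagrange.interpolate_apply, Polynomial.eval_finsetSum]
  refine Finset.sum_congr rfl fun j _ => ?_
  rw [Polynomial.eval_mul, Polynomial.eval_C, Lagrange.basis, Polynomial.eval_prod]
  congr 1
  refine Finset.prod_congr rfl fun m _ => ?_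
  simp [Lagrange.basisDivisor]
  ring

/-- Lagrange interpolation divided by the nodal polynomial. -/
theorem sum_partial_fractions {n : ℕ} (v : Fin n → ℂ) (hv : Function.Injective v)
    (p : Polynomial ℂ) (hp : p.degree < n) (z : ℂ) (hz : ∀ m, z ≠ v m) :
    ∑ j, p.eval (v j) / (∏ m ∈ Finset.univ.erase j, (v j - v m)) / (z - v j) =
      p.eval z / ∏ m, (z - v m) := by
  rw [eval_eq_sum_lagrange v hv p hp z, Finset.sum_div]
  refine Finset.sum_congr rfl fun j _ => ?_
  rw [← Finset.mul_prod_erase Finset.univ (fun m => z - v m) (Finset.mem_univ j),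
    Finset.prod_div_distrib]
  have h1 : ∏ m ∈ Finset.univ.erase j, (z - v m) ≠ 0 :=
    Finset.prod_ne_zero_iff.mpr fun m _ => sub_ne_zero.mpr (hz m)
  have h2 : ∏ m ∈ Finset.univ.erase j, (v j - v m) ≠ 0 :=
    Finset.prod_ne_zero_iff.mpr fun m hm =>
      sub_ne_zero.mpr fun h => (Finset.mem_erase.mp hm).1 (hv h).symm
  have h3 := sub_ne_zero.mpr (hz j)
  field_simp

theorem degree_prod_linear_lt {n : ℕ} (s : Finset (Fin n)) (f : Fin n → Polynomial ℂ)
    (hf : ∀ m, (f m).degree ≤ 1) (N : ℕ) (hs : s.card < N) :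
    (∏ m ∈ s, f m).degree < N := by
  refine lt_of_le_of_lt (Polynomial.degree_prod_le s f) ?_
  refine lt_of_le_of_lt (Finset.sum_le_card_nsmul s _ 1 fun m _ => hf m) ?_
  simp only [nsmul_eq_mul, mul_one]
  exact_mod_cast hs

/-- The coefficient of `β(u_i) ⊗ φ(x_j)` in the one-hook function. -/
noncomputable def hookCoeff {n : ℕ} (u x : Fin n → ℂ) (i j : Fin n) : ℂ :=
  (∏ m ∈ Finset.univ.erase j, (u i - x m)) * (∏ m, (u m - x j)) /
    (∏ m ∈ Finset.univ.erase i, (u i - u m)) / ∏ m ∈ Finset.univ.erase j, (x m - x j)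

section

variable {k : ℕ} (u x : Fin (k + 1) → ℂ) (hu : Function.Injective u) (hx : Function.Injective x)

local notation "U" => u (Fin.last k)
local notation "X" => x (Fin.last k)
local notation "u'" => fun i : Fin k => u (Fin.castSucc i)
local notation "x'" => fun i : Fin k => x (Fin.castSucc i)

theorem hookCoeff_castSucc_castSucc (i j : Fin k) :
    hookCoeff u x i.castSucc j.castSucc = hookCoeff u' x' i j *
      ((X - u i.castSucc) * (U - x j.castSucc) / ((U - u i.castSucc) * (X - x j.castSucc))) := by
  unfold hookCoeff
  rw [prod_erase_castSucc, prod_erase_castSucc, prod_erase_castSucc, Fin.prod_univ_castSucc]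
  have e : (X - u i.castSucc) / (U - u i.castSucc) = (u i.castSucc - X) / (u i.castSucc - U) := by
    rw [← neg_sub, ← neg_sub (u i.castSucc) U, neg_div_neg_eq]
  rw [mul_div_mul_comm (X - u i.castSucc), e]
  simp only [div_eq_mul_inv, mul_inv]
  ring

theorem injective_castSucc {v : Fin (k + 1) → ℂ} (hv : Function.Injective v) :
    Function.Injective fun i : Fin k => v i.castSucc :=
  hv.comp (Fin.castSucc_injective k)

theorem last_ne {v : Fin (k + 1) → ℂ} (hv : Function.Injective v) (i : Fin k) :
    v (Fin.last k) ≠ v i.castSucc := fun h => (Fin.castSucc_lt_last i).ne (hv h).symm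

include hu in
theorem sum_hookCoeff_left (j : Fin k) :
    ∑ i, hookCoeff u' x' i j / (U - u i.castSucc) =
      (∏ m ∈ Finset.univ.erase j, (U - x m.castSucc)) * (∏ m : Fin k, (u m.castSucc - x j.castSucc))
        / (∏ m : Fin k, (U - u m.castSucc)) /
        ∏ m ∈ Finset.univ.erase j, (x m.castSucc - x j.castSucc) := by
  have h := sum_partial_fractions u' (injective_castSucc hu)
    (∏ m ∈ Finset.univ.erase j, (Polynomial.X - Polynomial.C (x m.castSucc)))
    (degree_prod_linear_lt _ _ (fun m => (Polynomial.degree_X_sub_C _).le) _ (by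
      rw [Finset.card_erase_of_mem (Finset.mem_univ j)]
      have := j.pos
      simp; omega)) U (last_ne hu)
  simp only [Polynomial.eval_prod, Polynomial.eval_sub, Polynomial.eval_X, Polynomial.eval_C] at h
  rw [mul_div_right_comm, ← h, Finset.sum_mul, Finset.sum_div]
  refine Finset.sum_congr rfl fun i _ => ?_
  unfold hookCoeff
  simp only [div_eq_mul_inv]
  ring

include hx in
-- Partial fractions in the `x` variables. The nodes are taken at -x_m because ∏ (z + u_m) then has
-- the values ∏ (u_m - x_j) appearing in `hookCoeff`, without signs.
theorem sum_hookCoeff_right (i : Fin k) :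
    ∑ j, hookCoeff u' x' i j / (X - x j.castSucc) =
      - ((∏ m : Fin k, (u i.castSucc - x m.castSucc)) *
        (∏ m ∈ Finset.univ.erase i, (u m.castSucc - X)) /
        (∏ m ∈ Finset.univ.erase i, (u i.castSucc - u m.castSucc)) /
        ∏ m : Fin k, (x m.castSucc - X)) := by
  have h := sum_partial_fractions (fun m : Fin k => - x m.castSucc)
    (fun a b hab => injective_castSucc hx (neg_injective hab))
    (∏ m ∈ Finset.univ.erase i, (Polynomial.X + Polynomial.C (u m.castSucc)))
    (degree_prod_linear_lt _ _ (fun m => (Polynomial.degree_X_add_C _).le) _ (by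
      rw [Finset.card_erase_of_mem (Finset.mem_univ i)]
      have := i.pos
      simp; omega)) (-X) (fun m hm => last_ne hx m (neg_injective hm))
  simp only [Polynomial.eval_prod, Polynomial.eval_add, Polynomial.eval_X, Polynomial.eval_C,
    neg_add_eq_sub, sub_neg_eq_add] at h
  have e : -((∏ m : Fin k, (u i.castSucc - x m.castSucc)) *
        (∏ m ∈ Finset.univ.erase i, (u m.castSucc - X)) /
        (∏ m ∈ Finset.univ.erase i, (u i.castSucc - u m.castSucc)) /
        ∏ m : Fin k, (x m.castSucc - X)) =
      -((∏ m : Fin k, (u i.castSucc - x m.castSucc)) /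
        (∏ m ∈ Finset.univ.erase i, (u i.castSucc - u m.castSucc))) *
      ((∏ m ∈ Finset.univ.erase i, (u m.castSucc - X)) / ∏ m : Fin k, (x m.castSucc - X)) := by
    simp only [div_eq_mul_inv]
    ring
  rw [e, ← h, Finset.mul_sum]
  refine Finset.sum_congr rfl fun j _ => ?_
  unfold hookCoeff
  rw [← Finset.mul_prod_erase Finset.univ (fun m : Fin k => u i.castSucc - x m.castSucc)
    (Finset.mem_univ j), ← Finset.mul_prod_erase Finset.univ
    (fun m : Fin k => u m.castSucc - x j.castSucc) (Finset.mem_univ i),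
    ← neg_sub (x j.castSucc) X]
  simp only [div_eq_mul_inv, inv_neg]
  ring

include hu hx in
theorem hookCoeff_last_last :
    hookCoeff u x (Fin.last k) (Fin.last k) = (U - X) *
      (1 + (X - U) * ∑ j, (∑ i, hookCoeff u' x' i j / (U - u i.castSucc)) /
        (X - x j.castSucc)) := by
  -- Interpolation of ∏ (z + u_m), of degree `k`, at the k + 1 nodes -x_m. At z = -U the last node
  -- contributes the wanted coefficient and the others the double sum; the factors (-1)^k on both
  -- sides cancel.
  have h := eval_eq_sum_lagrange (fun m => - x m) (fun a b hab => hx (neg_injective hab))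
    (∏ m : Fin k, (Polynomial.X + Polynomial.C (u m.castSucc)))
    (degree_prod_linear_lt _ _ (fun m => (Polynomial.degree_X_add_C _).le) _ (by simp)) (-U)
  simp only [Polynomial.eval_prod, Polynomial.eval_add, Polynomial.eval_X, Polynomial.eval_C,
    neg_add_eq_sub, sub_neg_eq_add] at h
  have hneg : ∀ s : Finset (Fin k), ∀ f : Fin k → ℂ, (∏ m ∈ s, (f m - U)) =
      (-1) ^ s.card * ∏ m ∈ s, (U - f m) := by
    intro s f
    rw [← Finset.prod_neg]
    exact Finset.prod_congr rfl fun m _ => (neg_sub _ _).symm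
  have hneg' : ∀ j : Fin (k + 1), ∏ m ∈ Finset.univ.erase j, ((x m - U) / (x m - x j)) =
      (-1) ^ k * ∏ m ∈ Finset.univ.erase j, ((U - x m) / (x m - x j)) := by
    intro j
    have hc : (Finset.univ.erase j).card = k := by
      rw [Finset.card_erase_of_mem (Finset.mem_univ j)]; simp
    have e := Finset.prod_neg (s := Finset.univ.erase j) (f := fun m => (U - x m) / (x m - x j))
    rw [hc] at e
    rw [← e]
    refine Finset.prod_congr rfl fun m _ => ?_
    rw [← neg_div, neg_sub]
  rw [hneg, Finset.card_univ, Fintype.card_fin] at h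
  simp only [hneg', mul_left_comm _ ((-1 : ℂ) ^ k)] at h
  rw [← Finset.mul_sum] at h
  replace h := mul_left_cancel₀ (pow_ne_zero k (by norm_num)) h
  simp only [Fin.sum_univ_castSucc, prod_erase_castSucc, prod_erase_last,
    Finset.prod_div_distrib] at h
  have hU : ∏ m : Fin k, (U - u m.castSucc) ≠ 0 :=
    Finset.prod_ne_zero_iff.mpr fun m _ => sub_ne_zero.mpr (last_ne hu m)
  simp only [sum_hookCoeff_left u x hu]
  unfold hookCoeff
  rw [prod_erase_last, prod_erase_last, prod_erase_last, Fin.prod_univ_castSucc]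
  set P := ∏ m : Fin k, (U - u m.castSucc) with hP
  let S := ∑ j : Fin k, (∏ m ∈ Finset.univ.erase j, (U - x m.castSucc)) *
    (∏ m : Fin k, (u m.castSucc - x j.castSucc)) /
      (∏ m ∈ Finset.univ.erase j, (x m.castSucc - x j.castSucc)) / (X - x j.castSucc)
  have e1 : (∑ j : Fin k, (∏ m ∈ Finset.univ.erase j, (U - x m.castSucc)) *
      (∏ m : Fin k, (u m.castSucc - x j.castSucc)) / P /
      (∏ m ∈ Finset.univ.erase j, (x m.castSucc - x j.castSucc)) / (X - x j.castSucc)) =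
      S / P := by
    rw [Finset.sum_div]
    refine Finset.sum_congr rfl fun j _ => ?_
    simp only [div_eq_mul_inv]
    ring
  have e2 : P = (U - X) * S + (∏ m : Fin k, (u m.castSucc - X)) *
      ((∏ m : Fin k, (U - x m.castSucc)) / ∏ m : Fin k, (x m.castSucc - X)) := by
    rw [h, Finset.mul_sum]
    congr 1
    refine Finset.sum_congr rfl fun j _ => ?_
    simp only [div_eq_mul_inv, mul_inv]
    ring
  rw [e1]
  have e3 : (U - X) * (1 + (X - U) * (S / P)) = (U - X) * (P - (U - X) * S) / P := by
    field_simp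
    ring
  rw [e3, show P - (U - X) * S = (∏ m : Fin k, (u m.castSucc - X)) *
      ((∏ m : Fin k, (U - x m.castSucc)) / ∏ m : Fin k, (x m.castSucc - X)) by
    linear_combination e2]
  simp only [div_eq_mul_inv]
  ring

include hu in
theorem hookCoeff_last_castSucc (j : Fin k) :
    hookCoeff u x (Fin.last k) j.castSucc = (U - X) * (U - x j.castSucc) / (X - x j.castSucc) *
      ∑ i, hookCoeff u' x' i j / (U - u i.castSucc) := by
  rw [sum_hookCoeff_left u x hu]
  unfold hookCoeff
  rw [prod_erase_castSucc, prod_erase_castSucc, prod_erase_last, Fin.prod_univ_castSucc]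
  simp only [div_eq_mul_inv, mul_inv]
  ring

include hx in
theorem hookCoeff_castSucc_last (i : Fin k) :
    hookCoeff u x i.castSucc (Fin.last k) = (X - u i.castSucc) * (X - U) / (U - u i.castSucc) *
      ∑ j, hookCoeff u' x' i j / (X - x j.castSucc) := by
  rw [sum_hookCoeff_right u x hx]
  unfold hookCoeff
  rw [prod_erase_last, prod_erase_last, prod_erase_castSucc, Fin.prod_univ_castSucc,
    ← Finset.mul_prod_erase Finset.univ (fun m : Fin k => u m.castSucc - X) (Finset.mem_univ i),
    ← neg_sub U (u i.castSucc)]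
  simp only [div_eq_mul_inv, mul_inv, inv_neg]
  ring

include hu hx in
/-- The coefficient identity behind the addition of one row. -/
theorem sum_hookCoeff_succ (a f : Fin (k + 1) → ℂ) :
    (U - X) * a (Fin.last k) * f (Fin.last k) + ∑ i, ∑ j, hookCoeff u' x' i j *
      (((X - u i.castSucc) * a i.castSucc + (U - X) * a (Fin.last k)) / (U - u i.castSucc)) *
      (((U - x j.castSucc) * f j.castSucc + (X - U) * f (Fin.last k)) / (X - x j.castSucc)) =
    ∑ i, ∑ j, hookCoeff u x i j * a i * f j := by
  simp only [Fin.sum_univ_castSucc, Finset.sum_add_distrib]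
  -- The coefficients of a_i f_j are compared in four blocks, according to whether `i` and `j` are
  -- old or last; each block is one of the preceding formulas for `hookCoeff`.
  have e1 : ∑ i : Fin k, ∑ j : Fin k,
      hookCoeff u x i.castSucc j.castSucc * a i.castSucc * f j.castSucc =
      ∑ i : Fin k, ∑ j : Fin k, hookCoeff u' x' i j *
      ((X - u i.castSucc) * a i.castSucc / (U - u i.castSucc)) *
      ((U - x j.castSucc) * f j.castSucc / (X - x j.castSucc)) := by
    refine Finset.sum_congr rfl fun i _ => Finset.sum_congr rfl fun j _ => ?_
    rw [hookCoeff_castSucc_castSucc]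
    simp only [div_eq_mul_inv, mul_inv]
    ring
  have e2 : ∑ i : Fin k, hookCoeff u x i.castSucc (Fin.last k) * a i.castSucc * f (Fin.last k) =
      ∑ i : Fin k, ∑ j : Fin k, hookCoeff u' x' i j *
      ((X - u i.castSucc) * a i.castSucc / (U - u i.castSucc)) *
      ((X - U) * f (Fin.last k) / (X - x j.castSucc)) := by
    refine Finset.sum_congr rfl fun i _ => ?_
    rw [hookCoeff_castSucc_last u x hx, Finset.mul_sum, Finset.sum_mul, Finset.sum_mul]
    refine Finset.sum_congr rfl fun j _ => ?_
    simp only [div_eq_mul_inv]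
    ring
  have e3 : ∑ j : Fin k, hookCoeff u x (Fin.last k) j.castSucc * a (Fin.last k) * f j.castSucc =
      ∑ i : Fin k, ∑ j : Fin k, hookCoeff u' x' i j *
      ((U - X) * a (Fin.last k) / (U - u i.castSucc)) *
      ((U - x j.castSucc) * f j.castSucc / (X - x j.castSucc)) := by
    rw [Finset.sum_comm]
    refine Finset.sum_congr rfl fun j _ => ?_
    rw [hookCoeff_last_castSucc u x hu, Finset.mul_sum, Finset.sum_mul, Finset.sum_mul]
    refine Finset.sum_congr rfl fun i _ => ?_
    simp only [div_eq_mul_inv]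
    ring
  have e4 : hookCoeff u x (Fin.last k) (Fin.last k) * a (Fin.last k) * f (Fin.last k) =
      (U - X) * a (Fin.last k) * f (Fin.last k) + ∑ i : Fin k, ∑ j : Fin k, hookCoeff u' x' i j *
      ((U - X) * a (Fin.last k) / (U - u i.castSucc)) *
      ((X - U) * f (Fin.last k) / (X - x j.castSucc)) := by
    rw [hookCoeff_last_last u x hu hx, mul_add, mul_one, add_mul, add_mul, Finset.sum_comm]
    congr 1
    simp only [Finset.mul_sum, Finset.sum_mul, Finset.sum_div]
    refine Finset.sum_congr rfl fun j _ => Finset.sum_congr rfl fun i _ => ?_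
    simp only [div_eq_mul_inv]
    ring
  rw [e1, e2, e3, e4]
  have e5 : ∀ i j : Fin k, hookCoeff u' x' i j *
      (((X - u i.castSucc) * a i.castSucc + (U - X) * a (Fin.last k)) / (U - u i.castSucc)) *
      (((U - x j.castSucc) * f j.castSucc + (X - U) * f (Fin.last k)) / (X - x j.castSucc)) =
      hookCoeff u' x' i j * ((X - u i.castSucc) * a i.castSucc / (U - u i.castSucc)) *
        ((U - x j.castSucc) * f j.castSucc / (X - x j.castSucc)) +
      hookCoeff u' x' i j * ((X - u i.castSucc) * a i.castSucc / (U - u i.castSucc)) *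
        ((X - U) * f (Fin.last k) / (X - x j.castSucc)) +
      (hookCoeff u' x' i j * ((U - X) * a (Fin.last k) / (U - u i.castSucc)) *
        ((U - x j.castSucc) * f j.castSucc / (X - x j.castSucc)) +
      hookCoeff u' x' i j * ((U - X) * a (Fin.last k) / (U - u i.castSucc)) *
        ((X - U) * f (Fin.last k) / (X - x j.castSucc))) := by
    intro i j
    rw [add_div, add_div]
    ring
  simp only [e5, Finset.sum_add_distrib]
  ring

end

/-! ### The action of one row on the vectors β(z) and φ(z). -/

theorem sum_telescope {ι : Type*} [LinearOrder ι] (s : Finset ι) (f g : ι → ℂ) :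
    ∑ i ∈ s, (∏ j ∈ s with j < i, f j) * (g i - f i) * (∏ j ∈ s with i < j, g j) =
      ∏ i ∈ s, g i - ∏ i ∈ s, f i := by
  have h := Finset.prod_add_ordered s g (fun i => f i - g i)
  simp only [add_sub_cancel] at h
  rw [h, sub_add_cancel_left, ← Finset.sum_neg_distrib]
  refine Finset.sum_congr rfl fun i _ => ?_
  ring

section

variable (q y : ℕ → ℂ)

/-- The weight of a horizontal path crossing column `k`. -/
noncomputable def crossing (z : ℂ) (k : ℕ) : ℂ := (y k - z) / (q k - z)

/-- The weight of a path entering a row with parameters `x`, `u` in column `a` and leaving it in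
column `b`. -/
noncomputable def hopQ (x u : ℂ) (a b : ℕ) : ℂ :=
  if a = b then (q a - u) / (q a - x)
  else if a < b then (u - x) / (q a - x) * (∏ k ∈ Finset.Ioo a b, crossing q y x k) *
    ((q b - y b) / (q b - x))
  else 0

/-- The weight `β_a(z)` of a path leaving column `a` and crossing the columns up to `N`. -/
noncomputable def betaVec (N : ℕ) (a : ℕ) (z : ℂ) : ℂ :=
  1 / (q a - z) * ∏ k ∈ Finset.Ioc a N, crossing q y z k

/-- The weight `φ_b(z)` of a path crossing the columns after `N` and turning up in column `b`. -/
noncomputable def phiVec (N : ℕ) (b : ℕ) (z : ℂ) : ℂ :=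
  (q b - y b) / (q b - z) * ∏ k ∈ Finset.Ioo N b, crossing q y z k

variable {q y}

/-- Up to x - z this is the weight of turning up in column `k` with parameter `x` times the starting
factor of β_k(z). Sums over the turning column therefore telescope. -/
theorem crossing_sub {x z : ℂ} {k : ℕ} (hx : q k - x ≠ 0) (hz : q k - z ≠ 0) :
    crossing q y z k - crossing q y x k = (x - z) * (q k - y k) / ((q k - x) * (q k - z)) := by
  unfold crossing
  field_simp
  ring

/-- The block T₁₂ has rank at most one: a path crossing the line after column `N` splits there into
independent parts. -/
theorem hopQ_eq_mul {x u : ℂ} {N a b : ℕ} (ha : a ≤ N) (hb : N < b) :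
    hopQ q y x u a b = (u - x) * betaVec q y N a x * phiVec q y N b x := by
  unfold hopQ betaVec phiVec
  rw [if_neg (by omega), if_pos (by omega)]
  have : Finset.Ioo a b = Finset.Ioc a N ∪ Finset.Ioo N b := by
    ext k; simp only [Finset.mem_Ioo, Finset.mem_union, Finset.mem_Ioc]; omega
  rw [this, Finset.prod_union]
  · ring
  · rw [Finset.disjoint_left]
    intro k hk hk'
    simp only [Finset.mem_Ioo, Finset.mem_Ioc] at hk hk'
    omega

theorem hopQ_of_lt {x u : ℂ} {a b : ℕ} (h : b < a) : hopQ q y x u a b = 0 := by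
  unfold hopQ
  rw [if_neg (by omega), if_neg (by omega)]

theorem hopQ_self {x u : ℂ} {a : ℕ} : hopQ q y x u a a = (q a - u) / (q a - x) := by simp [hopQ]

/-- β(z) is an eigenvector of T₁₁ up to a multiple of β(x). The terms b > a telescope by
`crossing_sub`, from crossing with parameter `x` to crossing with parameter `z`. -/
theorem sum_hopQ_mul_betaVec {x u z : ℂ} {N a : ℕ} (ha : a ∈ Finset.Icc 1 N)
    (hx : ∀ k ∈ Finset.Icc 1 N, q k - x ≠ 0) (hz : ∀ k ∈ Finset.Icc 1 N, q k - z ≠ 0) :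
    (x - z) * ∑ b ∈ Finset.Icc 1 N, hopQ q y x u a b * betaVec q y N b z =
      (u - z) * betaVec q y N a z + (x - u) * betaVec q y N a x := by
  have ha' := Finset.mem_Icc.mp ha
  have h1 : ∑ b ∈ Finset.Icc 1 N, hopQ q y x u a b * betaVec q y N b z =
      hopQ q y x u a a * betaVec q y N a z +
      ∑ b ∈ Finset.Ioc a N, hopQ q y x u a b * betaVec q y N b z := by
    rw [← Finset.sum_insert (f := fun b => hopQ q y x u a b * betaVec q y N b z) (by simp)]
    symm
    refine Finset.sum_subset (fun b hb => ?_) fun b hb hb' => ?_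
    · simp only [Finset.mem_insert, Finset.mem_Ioc, Finset.mem_Icc] at *; omega
    · simp only [Finset.mem_insert, Finset.mem_Ioc, Finset.mem_Icc] at *
      rw [hopQ_of_lt (by omega), zero_mul]
  have h2 : (x - z) * ∑ b ∈ Finset.Ioc a N, hopQ q y x u a b * betaVec q y N b z =
      (u - x) / (q a - x) * (∏ k ∈ Finset.Ioc a N, crossing q y z k -
        ∏ k ∈ Finset.Ioc a N, crossing q y x k) := by
    rw [← sum_telescope, Finset.mul_sum, Finset.mul_sum]
    refine Finset.sum_congr rfl fun b hb => ?_
    have hb' := Finset.mem_Ioc.mp hb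
    have hbN : b ∈ Finset.Icc 1 N := Finset.mem_Icc.mpr (by omega)
    have e1 : (Finset.Ioc a N).filter (· < b) = Finset.Ioo a b := by
      ext k; simp only [Finset.mem_filter, Finset.mem_Ioc, Finset.mem_Ioo]; omega
    have e2 : (Finset.Ioc a N).filter (b < ·) = Finset.Ioc b N := by
      ext k; simp only [Finset.mem_filter, Finset.mem_Ioc]; omega
    rw [e1, e2, crossing_sub (hx b hbN) (hz b hbN)]
    unfold hopQ betaVec
    rw [if_neg (by omega), if_pos (by omega)]
    simp only [div_eq_mul_inv, mul_inv]
    ring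
  rw [h1, mul_add, h2, hopQ_self]
  unfold betaVec
  have n1 := hx a ha
  have n2 := hz a ha
  field_simp
  ring

theorem sum_hopQ_mul_betaVec_self {x u : ℂ} {N a : ℕ} (ha : a ∈ Finset.Icc 1 N)
    (hx : ∀ k ∈ Finset.Icc 1 N, q k - x ≠ 0) (hu : ∀ k ∈ Finset.Icc 1 N, q k - u ≠ 0) :
    ∑ b ∈ Finset.Icc 1 N, hopQ q y x u a b * betaVec q y N b u = betaVec q y N a x := by
  -- The case x = u is not excluded by the genericity assumptions, and division by x - u then fails;
  -- but the row acts as the identity.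
  by_cases h : x = u
  · subst h
    rw [Finset.sum_eq_single a]
    · rw [hopQ_self, div_self (hx a ha), one_mul]
    · intro b _ hb
      unfold hopQ
      rw [if_neg hb.symm]
      simp
    · exact fun h => absurd ha h
  · refine mul_left_cancel₀ (sub_ne_zero.mpr h) ?_
    rw [sum_hopQ_mul_betaVec ha hx hu]
    ring

theorem sum_phiVec_mul_hopQ {x u z : ℂ} {N L b : ℕ} (hb : b ∈ Finset.Ioc N L)
    (hx : ∀ k ∈ Finset.Ioc N L, q k - x ≠ 0) (hz : ∀ k ∈ Finset.Ioc N L, q k - z ≠ 0) :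
    (x - z) * ∑ c ∈ Finset.Ioc N L, phiVec q y N c z * hopQ q y x u c b =
      (u - z) * phiVec q y N b z + (x - u) * phiVec q y N b x := by
  have hb' := Finset.mem_Ioc.mp hb
  have h1 : ∑ c ∈ Finset.Ioc N L, phiVec q y N c z * hopQ q y x u c b =
      phiVec q y N b z * hopQ q y x u b b +
      ∑ c ∈ Finset.Ioo N b, phiVec q y N c z * hopQ q y x u c b := by
    rw [← Finset.sum_insert (f := fun c => phiVec q y N c z * hopQ q y x u c b) (by simp)]
    symm
    refine Finset.sum_subset (fun c hc => ?_) fun c hc hc' => ?_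
    · simp only [Finset.mem_insert, Finset.mem_Ioc, Finset.mem_Ioo] at *; omega
    · simp only [Finset.mem_insert, Finset.mem_Ioc, Finset.mem_Ioo] at *
      rw [hopQ_of_lt (by omega), mul_zero]
  have h2 : (x - z) * ∑ c ∈ Finset.Ioo N b, phiVec q y N c z * hopQ q y x u c b =
      (u - x) * ((q b - y b) / (q b - x)) * -(∏ k ∈ Finset.Ioo N b, crossing q y x k -
        ∏ k ∈ Finset.Ioo N b, crossing q y z k) := by
    rw [← sum_telescope, ← Finset.sum_neg_distrib, Finset.mul_sum, Finset.mul_sum]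
    refine Finset.sum_congr rfl fun c hc => ?_
    have hc' := Finset.mem_Ioo.mp hc
    have hcN : c ∈ Finset.Ioc N L := Finset.mem_Ioc.mpr (by omega)
    have e1 : (Finset.Ioo N b).filter (· < c) = Finset.Ioo N c := by
      ext k; simp only [Finset.mem_filter, Finset.mem_Ioo]; omega
    have e2 : (Finset.Ioo N b).filter (c < ·) = Finset.Ioo c b := by
      ext k; simp only [Finset.mem_filter, Finset.mem_Ioo]; omega
    rw [e1, e2, crossing_sub (hz c hcN) (hx c hcN)]
    unfold hopQ phiVec
    rw [if_neg (by omega), if_pos (by omega)]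
    simp only [div_eq_mul_inv, mul_inv]
    ring
  rw [h1, mul_add, h2, hopQ_self]
  unfold phiVec
  have n1 := hx b hb
  have n2 := hz b hb
  field_simp
  ring

variable (q y)

/-- The normalised weight of a single path from column `c ≤ N` to column `b > N`. -/
noncomputable def hookSum {k : ℕ} (N : ℕ) (u x : Fin k → ℂ) (c b : ℕ) : ℂ :=
  ∑ i, ∑ j, hookCoeff u x i j * betaVec q y N c (u i) * phiVec q y N b (x j)

variable {q y}

/-- In block form this reads T₁₂ + H_k T₂₂ = T₁₁ H_{k+1} for the last row. -/
theorem hookSum_step {k N L : ℕ} (hNL : N ≤ L) (u x : Fin (k + 1) → ℂ)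
    (hu : Function.Injective u) (hx : Function.Injective x)
    (hqx : ∀ c ∈ Finset.Icc 1 L, ∀ j, q c - x j ≠ 0)
    (hqu : ∀ c ∈ Finset.Icc 1 N, ∀ j, q c - u j ≠ 0)
    {e b : ℕ} (he : e ∈ Finset.Icc 1 N) (hb : b ∈ Finset.Ioc N L) :
    hopQ q y (x (Fin.last k)) (u (Fin.last k)) e b +
      ∑ c ∈ Finset.Ioc N L, hookSum q y N (fun i : Fin k => u i.castSucc)
        (fun i : Fin k => x i.castSucc) e c * hopQ q y (x (Fin.last k)) (u (Fin.last k)) c b =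
      ∑ c ∈ Finset.Icc 1 N, hopQ q y (x (Fin.last k)) (u (Fin.last k)) e c *
        hookSum q y N u x c b := by
  have hx1 : ∀ j, ∀ c ∈ Finset.Icc 1 N, q c - x j ≠ 0 := fun j c hc =>
    hqx c (Finset.Icc_subset_Icc_right hNL hc) j
  have hx2 : ∀ j, ∀ c ∈ Finset.Ioc N L, q c - x j ≠ 0 := fun j c hc =>
    hqx c (by simp only [Finset.mem_Ioc, Finset.mem_Icc] at *; omega) j
  have hu1 : ∀ j, ∀ c ∈ Finset.Icc 1 N, q c - u j ≠ 0 := fun j c hc => hqu c hc j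
  -- The entry `e` of T₁₁ β(u_i). For the last index it is β_e(x) with the last `x`, so the action
  -- formula can be solved for β_e(u_i) in terms of a_i and the last entry of `a`.
  let a : Fin (k + 1) → ℂ := fun i => ∑ c ∈ Finset.Icc 1 N,
    hopQ q y (x (Fin.last k)) (u (Fin.last k)) e c * betaVec q y N c (u i)
  have hR : ∑ c ∈ Finset.Icc 1 N, hopQ q y (x (Fin.last k)) (u (Fin.last k)) e c *
        hookSum q y N u x c b =
      ∑ i, ∑ j, hookCoeff u x i j * a i * phiVec q y N b (x j) := by
    simp only [hookSum, Finset.mul_sum, a, Finset.sum_mul]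
    rw [Finset.sum_comm]
    refine Finset.sum_congr rfl fun i _ => ?_
    rw [Finset.sum_comm]
    refine Finset.sum_congr rfl fun j _ => Finset.sum_congr rfl fun c _ => ?_
    ring
  have ha : a (Fin.last k) = betaVec q y N e (x (Fin.last k)) :=
    sum_hopQ_mul_betaVec_self he (hx1 _) (hu1 _)
  rw [hR, ← sum_hookCoeff_succ u x hu hx a fun j => phiVec q y N b (x j), ha,
    hopQ_eq_mul (Finset.mem_Icc.mp he).2 (Finset.mem_Ioc.mp hb).1]
  congr 1
  simp only [hookSum, Finset.sum_mul]
  rw [Finset.sum_comm]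
  refine Finset.sum_congr rfl fun i _ => ?_
  rw [Finset.sum_comm]
  refine Finset.sum_congr rfl fun j _ => ?_
  have h1 := sum_hopQ_mul_betaVec (q := q) (y := y) (u := u (Fin.last k)) he (hx1 (Fin.last k))
    (hu1 i.castSucc)
  have h2 := sum_phiVec_mul_hopQ (q := q) (y := y) (u := u (Fin.last k)) hb (hx2 (Fin.last k))
    (hx2 j.castSucc)
  have n1 : u (Fin.last k) - u i.castSucc ≠ 0 := sub_ne_zero.mpr (last_ne hu i)
  have n2 : x (Fin.last k) - x j.castSucc ≠ 0 := sub_ne_zero.mpr (last_ne hx j)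
  have h3 : ((x (Fin.last k) - u i.castSucc) * a i.castSucc + (u (Fin.last k) - x (Fin.last k)) *
      betaVec q y N e (x (Fin.last k))) / (u (Fin.last k) - u i.castSucc) =
      betaVec q y N e (u i.castSucc) := by
    rw [div_eq_iff n1]
    linear_combination h1
  have h4 : ((u (Fin.last k) - x j.castSucc) * phiVec q y N b (x j.castSucc) +
      (x (Fin.last k) - u (Fin.last k)) * phiVec q y N b (x (Fin.last k))) /
      (x (Fin.last k) - x j.castSucc) = ∑ c ∈ Finset.Ioc N L,
        phiVec q y N c (x j.castSucc) * hopQ q y (x (Fin.last k)) (u (Fin.last k)) c b := by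
    rw [div_eq_iff n2, ← h2]
    ring
  rw [h3, h4, Finset.mul_sum]
  refine Finset.sum_congr rfl fun c _ => ?_
  ring

end

/-! ### A single path through all rows and the block factorization B = A H. -/

/-- The total weight of a single path crossing several rows inside the columns `1, …, L`. -/
noncomputable def pathWeight (L : ℕ) : (k : ℕ) → (Fin k → ℕ → ℕ → ℂ) → ℕ → ℕ → ℂ
  | 0, _, a, b => if a = b then 1 else 0
  | k + 1, t, a, b => ∑ c ∈ Finset.Icc 1 L,
      pathWeight L k (fun j => t j.castSucc) a c * t (Fin.last k) c b

theorem sum_fin_eq_sum_Icc (L : ℕ) (f : ℕ → ℂ) :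
    ∑ c : Fin L, f (c + 1) = ∑ c ∈ Finset.Icc 1 L, f c := by
  rw [Fin.sum_univ_eq_sum_range (fun c => f (c + 1)), Finset.range_eq_Ico,
    Finset.sum_Ico_add' f 0 L 1]
  rfl

theorem ofFn_prod_eq_pathWeight (L k : ℕ) (t : Fin k → ℕ → ℕ → ℂ) (a b : Fin L) :
    (List.ofFn fun j => (Matrix.of fun a b : Fin L => t j (a + 1) (b + 1))).prod a b =
      pathWeight L k t (a + 1) (b + 1) := by
  induction k generalizing b with
  | zero =>
    simp [pathWeight, Matrix.one_apply, Fin.ext_iff]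
  | succ k ih =>
    rw [List.ofFn_succ', List.concat_eq_append, List.prod_append, List.prod_singleton,
      Matrix.mul_apply, pathWeight, ← sum_fin_eq_sum_Icc]
    refine Finset.sum_congr rfl fun c _ => ?_
    rw [ih (fun j => t j.castSucc) c, Matrix.of_apply]

theorem pathWeight_of_lt {L k : ℕ} (t : Fin k → ℕ → ℕ → ℂ)
    (ht : ∀ j a b, b < a → t j a b = 0) {a b : ℕ} (h : b < a) : pathWeight L k t a b = 0 := by
  induction k generalizing b with
  | zero => rw [pathWeight, if_neg (by omega)]
  | succ k ih =>
    rw [pathWeight]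
    refine Finset.sum_eq_zero fun c _ => ?_
    rcases lt_or_ge c a with hc | hc
    · rw [ih (fun j => t j.castSucc) (fun j => ht _) hc, zero_mul]
    · rw [ht _ _ _ (by omega), mul_zero]

theorem pathWeight_self {L k : ℕ} (t : Fin k → ℕ → ℕ → ℂ)
    (ht : ∀ j a b, b < a → t j a b = 0) {a : ℕ} (h : a ∈ Finset.Icc 1 L) :
    pathWeight L k t a a = ∏ j, t j a a := by
  induction k with
  | zero => simp [pathWeight]
  | succ k ih =>
    rw [pathWeight, Finset.sum_eq_single a, ih _ (fun j => ht _), Fin.prod_univ_castSucc]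
    · intro c _ hc
      rcases lt_or_gt_of_ne hc with hc | hc
      · rw [pathWeight_of_lt _ (fun j => ht _) hc, zero_mul]
      · rw [ht _ _ _ hc, mul_zero]
    · exact fun h' => absurd h h'

/-- Induction on the rows: B_{k+1} = A_k T₁₂ + B_k T₂₂ = A_k (T₁₂ + H_k T₂₂) = A_k T₁₁ H_{k+1} =
A_{k+1} H_{k+1}. -/
theorem pathWeight_eq_sum_hookSum {q y : ℕ → ℂ} {k N L : ℕ} (hNL : N ≤ L) (u x : Fin k → ℂ)
    (hu : Function.Injective u) (hx : Function.Injective x)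
    (hqx : ∀ c ∈ Finset.Icc 1 L, ∀ j, q c - x j ≠ 0)
    (hqu : ∀ c ∈ Finset.Icc 1 N, ∀ j, q c - u j ≠ 0)
    {a b : ℕ} (ha : a ∈ Finset.Icc 1 N) (hb : b ∈ Finset.Ioc N L) :
    pathWeight L k (fun j => hopQ q y (x j) (u j)) a b =
      ∑ c ∈ Finset.Icc 1 N, pathWeight L k (fun j => hopQ q y (x j) (u j)) a c *
        hookSum q y N u x c b := by
  induction k generalizing b with
  | zero =>
    have hab : a ≠ b := by
      simp only [Finset.mem_Icc, Finset.mem_Ioc] at *; omega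
    simp [pathWeight, hookSum, hab]
  | succ k ih =>
    have hsplit : Finset.Icc 1 L = Finset.Icc 1 N ∪ Finset.Ioc N L := by
      ext c; simp only [Finset.mem_Icc, Finset.mem_union, Finset.mem_Ioc]; omega
    have hdisj : Disjoint (Finset.Icc 1 N) (Finset.Ioc N L) := by
      rw [Finset.disjoint_left]
      intro c hc hc'
      simp only [Finset.mem_Icc, Finset.mem_Ioc] at hc hc'
      omega
    let pw := pathWeight L k fun j => hopQ q y (x j.castSucc) (u j.castSucc)
    let T := hopQ q y (x (Fin.last k)) (u (Fin.last k))
    have hL : ∀ c, pathWeight L (k + 1) (fun j => hopQ q y (x j) (u j)) a c =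
        ∑ e ∈ Finset.Icc 1 N, pw a e * T e c + ∑ e ∈ Finset.Ioc N L, pw a e * T e c := by
      intro c
      rw [pathWeight, hsplit, Finset.sum_union hdisj]
    have hlow : ∀ c ∈ Finset.Icc 1 N, pathWeight L (k + 1) (fun j => hopQ q y (x j) (u j)) a c =
        ∑ e ∈ Finset.Icc 1 N, pw a e * T e c := by
      intro c hc
      rw [hL, add_eq_left]
      refine Finset.sum_eq_zero fun e he => ?_
      simp only [Finset.mem_Icc, Finset.mem_Ioc] at hc he
      have : T e c = 0 := hopQ_of_lt (by omega)
      rw [this, mul_zero]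
    have hih : ∀ e ∈ Finset.Ioc N L, pw a e = ∑ c ∈ Finset.Icc 1 N, pw a c *
        hookSum q y N (fun i : Fin k => u i.castSucc) (fun i : Fin k => x i.castSucc) c e :=
      fun e he => ih _ _ (injective_castSucc hu) (injective_castSucc hx)
        (fun c hc j => hqx c hc _) (fun c hc j => hqu c hc _) he
    rw [hL, Finset.sum_congr rfl fun c hc => congrArg (· * hookSum q y N u x c b) (hlow c hc),
      Finset.sum_congr rfl fun e he => congrArg (· * T e b) (hih e he)]
    simp only [Finset.sum_mul]
    rw [Finset.sum_comm (s := Finset.Ioc N L), ← Finset.sum_add_distrib,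
      Finset.sum_comm (s := Finset.Icc 1 N) (t := Finset.Icc 1 N)]
    refine Finset.sum_congr rfl fun e he => ?_
    have h := hookSum_step hNL u x hu hx hqx hqu (y := y) he hb
    simp only [mul_assoc, ← Finset.mul_sum]
    rw [← mul_add, h]

/-! ### Minors of the hook coefficients and of the hook function. -/

theorem prod_enum {ι : Type*} [LinearOrder ι] {n : ℕ} (I : {I : Finset ι // I.card = n})
    (f : ι → ℂ) : ∏ a, f (enum I a) = ∏ i ∈ I.1, f i := by
  have h := Finset.prod_map Finset.univ (enum I).toEmbedding f
  rw [Finset.map_orderEmbOfFin_univ] at h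
  exact h.symm

theorem prod_Ioi_enum {ι : Type*} [LinearOrder ι] {n : ℕ} (I : {I : Finset ι // I.card = n})
    (f : ι → ι → ℂ) : ∏ a, ∏ a' ∈ Finset.Ioi a, f (enum I a) (enum I a') =
      ∏ i ∈ I.1, ∏ j ∈ I.1 with i < j, f i j := by
  rw [← prod_enum I]
  refine Finset.prod_congr rfl fun a _ => ?_
  rw [Finset.prod_filter, ← prod_enum I, ← Finset.prod_filter]
  refine Finset.prod_congr ?_ fun _ _ => rfl
  ext a'
  simp

theorem prod_erase_eq_mul_of_mem {M : ℕ} (I : Finset (Fin M)) {i : Fin M} (hi : i ∈ I)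
    (f : Fin M → ℂ) : ∏ m ∈ Finset.univ.erase i, f m =
      (∏ m ∈ Iᶜ, f m) * ((∏ m ∈ I with i < m, f m) * ∏ m ∈ I with m < i, f m) := by
  have h1 : Finset.univ.erase i = Iᶜ ∪ (I.filter (i < ·) ∪ I.filter (· < i)) := by
    ext m
    simp only [Finset.mem_erase, Finset.mem_univ, and_true, Finset.mem_union,
      Finset.mem_compl, Finset.mem_filter]
    constructor
    · intro h
      by_cases hm : m ∈ I
      · rcases lt_or_gt_of_ne h with h | h
        · exact Or.inr (Or.inr ⟨hm, h⟩)
        · exact Or.inr (Or.inl ⟨hm, h⟩)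
      · exact Or.inl hm
    · rintro (h | h | h)
      · rintro rfl
        exact h hi
      · exact h.2.ne'
      · exact h.2.ne
  rw [h1, Finset.prod_union, Finset.prod_union]
  · rw [Finset.disjoint_left]
    intro m hm hm'
    exact lt_asymm (Finset.mem_filter.mp hm).2 (Finset.mem_filter.mp hm').2
  · rw [Finset.disjoint_left]
    intro m hm hm'
    rw [← Finset.filter_or] at hm'
    exact Finset.mem_compl.mp hm (Finset.mem_filter.mp hm').1

theorem prod_prod_lt_swap {M : ℕ} (I : Finset (Fin M)) (f : Fin M → Fin M → ℂ) :
    ∏ i ∈ I, ∏ m ∈ I with m < i, f i m = ∏ i ∈ I, ∏ m ∈ I with i < m, f m i := by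
  refine Finset.prod_comm' fun i m => ?_
  simp only [Finset.mem_filter]
  tauto

theorem prod_erase_enum {M n : ℕ} (J : {J : Finset (Fin M) // J.card = n}) (b : Fin n)
    (f : Fin M → ℂ) : ∏ m ∈ Finset.univ.erase (enum J b), f m =
      (∏ m ∈ J.1ᶜ, f m) * ∏ b' ∈ Finset.univ.erase b, f (enum J b') := by
  have h1 : Finset.univ.erase (enum J b) =
      J.1ᶜ ∪ (Finset.univ.erase b).map (enum J).toEmbedding := by
    rw [Finset.map_erase, Finset.map_orderEmbOfFin_univ]
    ext m
    simp only [Finset.mem_erase, Finset.mem_univ, and_true, Finset.mem_union, Finset.mem_compl]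
    constructor
    · intro h
      by_cases hm : m ∈ J.1
      · exact Or.inr ⟨h, hm⟩
      · exact Or.inl hm
    · rintro (h | h)
      · rintro rfl
        exact h (Finset.orderEmbOfFin_mem _ _ _)
      · exact h.1
  rw [h1, Finset.prod_union, Finset.prod_map]
  · rfl
  · rw [Finset.disjoint_left]
    intro m hm hm'
    obtain ⟨b', -, rfl⟩ := Finset.mem_map.mp hm'
    exact Finset.mem_compl.mp hm (Finset.orderEmbOfFin_mem _ _ _)

/-- After extracting a factor α from each row and β from each column, the Lagrange products for u on
I and x on J remain. The two products in their determinant cancel one ordering of the differences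
within I and within J from the denominators, which is why only i < j survives. -/
theorem det_hookCoeff {M d : ℕ} (u x : Fin M → ℂ) (hu : Function.Injective u)
    (hx : Function.Injective x) (I J : {I : Finset (Fin M) // I.card = d}) :
    ((Matrix.of (hookCoeff u x)).submatrix (enum I) (enum J)).det =
      (∏ i ∈ J.1ᶜ, ∏ j ∈ J.1, 1 / (x i - x j)) *
      (∏ i ∈ J.1, ∏ j ∈ J.1 with i < j, 1 / (x j - x i)) *
      (∏ i ∈ I.1, ∏ j : Fin M, (u i - x j)) *
      (∏ i ∈ I.1ᶜ, ∏ j ∈ J.1, (u i - x j)) *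
      (∏ i ∈ I.1, ∏ j ∈ I.1ᶜ, 1 / (u i - u j)) *
      (∏ i ∈ I.1, ∏ j ∈ I.1 with i < j, 1 / (u i - u j)) := by
  let α : Fin M → ℂ := fun i =>
    (∏ m ∈ J.1ᶜ, (u i - x m)) / ∏ m ∈ Finset.univ.erase i, (u i - u m)
  let β : Fin M → ℂ := fun j =>
    (∏ m, (u m - x j)) / ∏ m ∈ Finset.univ.erase j, (x m - x j)
  have h1 : (Matrix.of (hookCoeff u x)).submatrix (enum I) (enum J) =
      Matrix.of fun a b => α (enum I a) * (Matrix.of (fun a b => β (enum J b) *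
        (Matrix.of fun a b : Fin d => ∏ b' ∈ Finset.univ.erase b,
          (u (enum I a) - x (enum J b'))) a b)) a b := by
    ext a b
    simp only [Matrix.submatrix_apply, Matrix.of_apply, hookCoeff, α, β, prod_erase_enum J b
      (fun m => u (enum I a) - x m)]
    simp only [div_eq_mul_inv]
    ring
  rw [h1, Matrix.det_mul_column, Matrix.det_mul_row,
    det_lagrange_products (fun a => u (enum I a)) (fun b => x (enum J b))
      (hx.comp (enum J).injective), prod_enum I α, prod_enum J β,
    prod_Ioi_enum I (fun i j => u j - u i), prod_Ioi_enum J (fun i j => x i - x j)]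
  have hα : ∏ i ∈ I.1, α i = (∏ i ∈ I.1, ∏ m ∈ J.1ᶜ, (u i - x m)) *
      ((∏ i ∈ I.1, ∏ j ∈ I.1ᶜ, 1 / (u i - u j)) *
      ((∏ i ∈ I.1, ∏ j ∈ I.1 with i < j, 1 / (u i - u j)) *
        (∏ i ∈ I.1, ∏ j ∈ I.1 with i < j, (u j - u i))⁻¹)) := by
    have e : ∏ i ∈ I.1, ∏ m ∈ Finset.univ.erase i, (u i - u m) =
        (∏ i ∈ I.1, ∏ j ∈ I.1ᶜ, (u i - u j)) * ((∏ i ∈ I.1, ∏ j ∈ I.1 with i < j, (u i - u j)) *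
          (∏ i ∈ I.1, ∏ j ∈ I.1 with i < j, (u j - u i))) := by
      rw [Finset.prod_congr rfl fun i hi => prod_erase_eq_mul_of_mem I.1 hi _,
        Finset.prod_mul_distrib, Finset.prod_mul_distrib,
        prod_prod_lt_swap I.1 (fun i m => u i - u m)]
    simp only [α, Finset.prod_div_distrib, e, Finset.prod_const_one]
    simp only [div_eq_mul_inv, mul_inv, one_mul]
  have hβ : ∏ j ∈ J.1, β j = (∏ j ∈ J.1, ∏ m, (u m - x j)) *
      ((∏ i ∈ J.1ᶜ, ∏ j ∈ J.1, 1 / (x i - x j)) *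
      ((∏ i ∈ J.1, ∏ j ∈ J.1 with i < j, 1 / (x j - x i)) *
        (∏ i ∈ J.1, ∏ j ∈ J.1 with i < j, (x i - x j))⁻¹)) := by
    have e : ∏ j ∈ J.1, ∏ m ∈ Finset.univ.erase j, (x m - x j) =
        (∏ i ∈ J.1ᶜ, ∏ j ∈ J.1, (x i - x j)) * ((∏ i ∈ J.1, ∏ j ∈ J.1 with i < j, (x j - x i)) *
          (∏ i ∈ J.1, ∏ j ∈ J.1 with i < j, (x i - x j))) := by
      rw [Finset.prod_congr rfl fun i hi => prod_erase_eq_mul_of_mem J.1 hi _,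
        Finset.prod_mul_distrib, Finset.prod_mul_distrib, Finset.prod_comm (s := J.1) (t := J.1ᶜ),
        prod_prod_lt_swap J.1 (fun i m => x m - x i)]
    simp only [β, Finset.prod_div_distrib, e, Finset.prod_const_one]
    simp only [div_eq_mul_inv, mul_inv, one_mul]
  have hnI : ∏ i ∈ I.1, ∏ j ∈ I.1 with i < j, (u j - u i) ≠ 0 :=
    Finset.prod_ne_zero_iff.mpr fun i _ => Finset.prod_ne_zero_iff.mpr fun j hj =>
      sub_ne_zero.mpr fun h => (Finset.mem_filter.mp hj).2.ne (hu h).symm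
  have hnJ : ∏ i ∈ J.1, ∏ j ∈ J.1 with i < j, (x i - x j) ≠ 0 :=
    Finset.prod_ne_zero_iff.mpr fun i _ => Finset.prod_ne_zero_iff.mpr fun j hj =>
      sub_ne_zero.mpr fun h => (Finset.mem_filter.mp hj).2.ne (hx h)
  -- Both sides run over the index pairs in I × Jᶜ, I × J and Iᶜ × J.
  have hux : (∏ i ∈ I.1, ∏ m ∈ J.1ᶜ, (u i - x m)) * (∏ j ∈ J.1, ∏ m, (u m - x j)) =
      (∏ i ∈ I.1, ∏ j : Fin M, (u i - x j)) * ∏ i ∈ I.1ᶜ, ∏ j ∈ J.1, (u i - x j) := by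
    have e1 : ∏ i ∈ I.1, ∏ j : Fin M, (u i - x j) =
        (∏ i ∈ I.1, ∏ m ∈ J.1ᶜ, (u i - x m)) * ∏ i ∈ I.1, ∏ m ∈ J.1, (u i - x m) := by
      rw [← Finset.prod_mul_distrib]
      refine Finset.prod_congr rfl fun i _ => ?_
      rw [mul_comm, Finset.prod_mul_prod_compl]
    rw [e1, mul_assoc, Finset.prod_mul_prod_compl I.1 (fun i => ∏ j ∈ J.1, (u i - x j)),
      Finset.prod_comm (s := J.1)]
  rw [hα, hβ]
  set P := ∏ i ∈ I.1, ∏ j ∈ I.1 with i < j, (u j - u i)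
  set Q := ∏ i ∈ J.1, ∏ j ∈ J.1 with i < j, (x i - x j)
  have hPP : P⁻¹ * P = 1 := inv_mul_cancel₀ hnI
  have hQQ : Q⁻¹ * Q = 1 := inv_mul_cancel₀ hnJ
  rw [mul_assoc _ (∏ i ∈ I.1, ∏ j : Fin M, (u i - x j)), ← hux]
  set A1 := ∏ i ∈ I.1, ∏ m ∈ J.1ᶜ, (u i - x m)
  set A2 := ∏ j ∈ J.1, ∏ m, (u m - x j)
  set A3 := ∏ i ∈ I.1, ∏ j ∈ I.1ᶜ, 1 / (u i - u j)
  set A4 := ∏ i ∈ I.1, ∏ j ∈ I.1 with i < j, 1 / (u i - u j)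
  set A5 := ∏ i ∈ J.1ᶜ, ∏ j ∈ J.1, 1 / (x i - x j)
  set A6 := ∏ i ∈ J.1, ∏ j ∈ J.1 with i < j, 1 / (x j - x i)
  calc A1 * (A3 * (A4 * P⁻¹)) * (A2 * (A5 * (A6 * Q⁻¹)) * (P * Q))
      = A5 * A6 * (A1 * A2) * A3 * A4 * (P⁻¹ * P) * (Q⁻¹ * Q) := by ring
    _ = A5 * A6 * (A1 * A2) * A3 * A4 := by rw [hPP, hQQ, mul_one, mul_one]

/-- Expansion of the minors of the one-hook function. -/
theorem det_hookSum {M N d : ℕ} (q y : ℕ → ℂ) (u x : Fin M → ℂ) (μ l : Fin d → ℕ) :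
    (Matrix.of fun m h : Fin d => hookSum q y N u x (μ m) (l h)).det =
      ∑ I : {I : Finset (Fin M) // I.card = d}, ∑ J : {J : Finset (Fin M) // J.card = d},
        ((Matrix.of (hookCoeff u x)).submatrix (enum I) (enum J)).det *
        ((∑ σ : Equiv.Perm (Fin d), ((Equiv.Perm.sign σ : ℤ) : ℂ) *
          ∏ m, betaVec q y N (μ m) (u (enum I (σ m)))) *
        ∑ ρ : Equiv.Perm (Fin d), ((Equiv.Perm.sign ρ : ℤ) : ℂ) *
          ∏ h, phiVec q y N (l h) (x (enum J (ρ h)))) := by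
  let B : Matrix (Fin d) (Fin M) ℂ := Matrix.of fun m i => betaVec q y N (μ m) (u i)
  let C : Matrix (Fin M) (Fin M) ℂ := Matrix.of (hookCoeff u x)
  let Φ : Matrix (Fin M) (Fin d) ℂ := Matrix.of fun j h => phiVec q y N (l h) (x j)
  have h1 : (Matrix.of fun m h : Fin d => hookSum q y N u x (μ m) (l h)) = B * (C * Φ) := by
    ext m h
    simp only [Matrix.mul_apply, B, C, Φ, Matrix.of_apply, hookSum, Finset.mul_sum]
    refine Finset.sum_congr rfl fun i _ => Finset.sum_congr rfl fun j _ => ?_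
    ring
  rw [h1, det_mul_cauchyBinet]
  refine Finset.sum_congr rfl fun I _ => ?_
  have h2 : (C * Φ).submatrix (enum I) id = C.submatrix (enum I) id * Φ := rfl
  rw [h2, det_mul_cauchyBinet, Finset.mul_sum]
  refine Finset.sum_congr rfl fun J _ => ?_
  -- The transpose puts the permutation on the index of I, so that it selects the variable paired
  -- with μ_m.
  rw [← Matrix.det_transpose (B.submatrix id (enum I)), Matrix.det_apply',
    Matrix.det_apply' (Φ.submatrix (enum J) id)]
  rw [mul_left_comm]
  rfl

/-! ### Signatures and the reduction to a minor of size d. -/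

section

variable {N : ℕ} (lam : Signature N)

theorem mu_mem (m : Fin lam.durfee) : lam.mu m ∈ lam.muSet := Finset.orderEmbOfFin_mem _ _ _

theorem ell_strictAnti : StrictAnti lam.ell := by
  intro i j hij
  have h1 := lam.anti hij.le
  have h2 : (i : ℕ) < j := hij
  have h3 := j.2
  unfold Signature.ell
  omega

theorem ell_le_iff (j : Fin N) : lam.ell j ≤ N ↔ lam.durfee ≤ (j : ℕ) := by
  have := lam.lt_durfee_iff j
  unfold Signature.ell
  omega

theorem ell_pos (j : Fin N) : 1 ≤ lam.ell j := by
  have := j.2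
  unfold Signature.ell
  omega

theorem ell_le (hN : 0 < N) (j : Fin N) : lam.ell j ≤ lam.parts ⟨0, hN⟩ + N := by
  have := lam.anti (Fin.mk_le_of_le_val (Nat.zero_le j) : (⟨0, hN⟩ : Fin N) ≤ j)
  unfold Signature.ell
  omega

theorem mem_muSet_iff (a : ℕ) : a ∈ lam.muSet ↔ a ∈ Finset.Icc 1 N ∧ ∀ j, lam.ell j ≠ a := by
  unfold Signature.muSet Signature.pts
  simp only [Finset.mem_sdiff, Finset.mem_inter, Finset.mem_image, Finset.mem_univ, true_and,
    not_and]
  constructor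
  · rintro ⟨h1, h2⟩
    exact ⟨h1, fun j hj => h2 ⟨j, hj⟩ h1⟩
  · rintro ⟨h1, h2⟩
    exact ⟨h1, fun ⟨j, hj⟩ => absurd hj (h2 j)⟩

theorem prod_fin_eq_prod_Icc (f : ℕ → ℂ) :
    ∏ c : Fin N, f (N - c) = ∏ c ∈ Finset.Icc 1 N, f c := by
  rw [← Equiv.prod_comp Fin.revPerm]
  have h : ∀ c : Fin N, N - (Fin.revPerm c : ℕ) = (c : ℕ) + 1 := by
    intro c
    simp only [Fin.revPerm_apply, Fin.val_rev]
    omega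
  simp only [h]
  rw [Fin.prod_univ_eq_prod_range (fun c => f (c + 1)), Finset.range_eq_Ico,
    Finset.prod_Ico_add' f 0 N 1]
  rfl

theorem sum_fin_sub_eq_sum_Icc (f : ℕ → ℂ) :
    ∑ c : Fin N, f (N - c) = ∑ c ∈ Finset.Icc 1 N, f c := by
  rw [← Equiv.sum_comp Fin.revPerm]
  have h : ∀ c : Fin N, N - (Fin.revPerm c : ℕ) = (c : ℕ) + 1 := by
    intro c
    simp only [Fin.revPerm_apply, Fin.val_rev]
    omega
  simp only [h]
  exact sum_fin_eq_sum_Icc N f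

/-- Reduction of a determinant indexed by `N, …, 1` and `ℓ_1, …, ℓ_N` to a `d × d` minor. -/
theorem det_reduction (R : ℕ → ℕ → ℂ) :
    (Matrix.of fun c j : Fin N => if lam.ell j ≤ N then (if N - (c : ℕ) = lam.ell j then (1 : ℂ)
      else 0) else R (N - c) (lam.ell j)).det =
      (∏ m, (-1 : ℂ) ^ (N - lam.mu m)) *
        (Matrix.of fun m h => R (lam.mu m) (lam.ellTop h)).det := by
  have hmu : ∀ m, 1 ≤ lam.mu m ∧ lam.mu m ≤ N := fun m =>
    Finset.mem_Icc.mp ((mem_muSet_iff lam _).mp (mu_mem lam m)).1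
  -- Row `c` stands for column N - c, so the increasing μ_m become decreasing row indices, as
  -- `det_of_unit_columns` requires. In `e`, the truncated value 0 for ℓ_k > N is never used.
  let g : Fin lam.durfee → Fin N := fun m => ⟨N - lam.mu m, by have := hmu m; omega⟩
  let e : Fin N → Fin N := fun k => ⟨N - lam.ell k, by
    have := ell_pos lam k; have := k.2; omega⟩
  rw [det_of_unit_columns lam.durfee_le _ g e]
  · congr 2
    ext m h
    have h1 := hmu m
    have h2 : ¬ lam.ell (Fin.castLE lam.durfee_le h) ≤ N := by
      rw [ell_le_iff]
      simp
    simp only [Matrix.submatrix_apply, Matrix.of_apply, g, if_neg h2]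
    rw [Nat.sub_sub_self h1.2]
    rfl
  · intro i j hi hij
    have h1 := (ell_le_iff lam i).mpr hi
    have h2 := ell_strictAnti lam hij
    simp only [e, Fin.mk_lt_mk]
    omega
  · intro m m' h
    have h1 : lam.mu m < lam.mu m' := by
      unfold Signature.mu
      simpa using h
    have h2 := hmu m'
    simp only [g, Fin.mk_lt_mk]
    omega
  · intro c k hk h
    have h1 := (ell_le_iff lam k).mpr hk
    have h2 := hmu c
    simp only [g, e, Fin.mk.injEq] at h
    exact ((mem_muSet_iff lam _).mp (mu_mem lam c)).2 k (by omega)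
  · intro i
    by_cases h : ∃ k, lam.ell k = N - i
    · right
      obtain ⟨k, hk⟩ := h
      refine ⟨k, (ell_le_iff lam k).mp (by omega), ?_⟩
      ext
      simp only [e]
      omega
    · left
      have h1 : N - (i : ℕ) ∈ lam.muSet := by
        rw [mem_muSet_iff]
        refine ⟨Finset.mem_Icc.mpr (by omega), fun j hj => h ⟨j, hj⟩⟩
      have h2 : N - (i : ℕ) ∈ Set.range (lam.muSet.orderEmbOfFin lam.card_muSet) := by
        rw [Finset.range_orderEmbOfFin]
        exact h1
      obtain ⟨m, hm⟩ := h2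
      refine ⟨m, ?_⟩
      ext
      simp only [g, Signature.mu, hm]
      omega
  · intro i k hk
    have h1 := (ell_le_iff lam k).mpr hk
    have h2 := ell_pos lam k
    rw [Matrix.of_apply, if_pos h1]
    refine if_congr ?_ rfl rfl
    rw [Fin.ext_iff]
    simp only [e]
    omega

end

/-! ### Specialization to the six vertex weights and conclusion. -/

theorem zpow_neg_two_mul_sub {s : ℂ} (hs : s ≠ 0) (y z : ℂ) :
    s ^ (-2 : ℤ) * y - z = (y - s ^ 2 * z) / s ^ 2 := by
  rw [zpow_neg, zpow_ofNat]
  field_simp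

theorem hop_colW {M : ℕ} (x r : Fin M → ℂ) (y s : ℕ → ℂ) (j : Fin M) (a b : ℕ) :
    hop (colW x r y s j) a b =
      hopQ (fun k => s k ^ (-2 : ℤ) * y k) y (x j) (r j ^ (-2 : ℤ) * x j) a b := by
  unfold hop hopQ
  split_ifs
  · rfl
  · change x j * (r j ^ (-2 : ℤ) - 1) / (s a ^ (-2 : ℤ) * y a - x j) *
      (∏ k ∈ Finset.Ioo a b, crossing (fun k => s k ^ (-2 : ℤ) * y k) y (x j) k) *
      (y b * (s b ^ (-2 : ℤ) - 1) / (s b ^ (-2 : ℤ) * y b - x j)) = _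
    congr 3
    · ring
    · ring
  · rfl

/-- The free fermion relation, and the only place where the value of `W` at the fully occupied
vertex matters. -/
theorem colW_freeFermion {M : ℕ} (x r : Fin M → ℂ) (y s : ℕ → ℂ) (j : Fin M) (c : ℕ)
    (h : s c ^ (-2 : ℤ) * y c - x j ≠ 0) :
    colW x r y s j c true true true true =
      colW x r y s j c true false false true * colW x r y s j c false true true false -
        colW x r y s j c true false true false * colW x r y s j c false true false true := by
  simp only [colW, W]
  rw [div_mul_div_comm, div_mul_div_comm, ← sub_div, div_eq_div_iff h (mul_ne_zero h h)]
  ring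

section

variable {M N : ℕ} {x r : Fin M → ℂ} {y s : ℕ → ℂ} (lam : Signature N)

theorem G_eq_det (hN : 0 < N)
    (hq : ∀ k ∈ Finset.Icc 1 (lam.parts ⟨0, hN⟩ + N), ∀ j, s k ^ (-2 : ℤ) * y k - x j ≠ 0) :
    G lam x y r s = (Matrix.of fun i j : Fin N =>
      pathWeight (lam.parts ⟨0, hN⟩ + N) M (fun j => hopQ (fun k => s k ^ (-2 : ℤ) * y k) y
        (x j) (r j ^ (-2 : ℤ) * x j)) (N - i) (lam.ell j)).det := by
  set L := lam.parts ⟨0, hN⟩ + N with hL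
  -- Entry columns N, …, 1 and exit columns ℓ_1, …, ℓ_N, shifted by one because `Fin L` starts at 0.
  let a : Fin N → Fin L := fun i => ⟨N - i - 1, by have := i.2; omega⟩
  let b : Fin N → Fin L := fun i => ⟨lam.ell i - 1, by
    have := ell_le lam hN i; have := ell_pos lam i; omega⟩
  have ha1 : ∀ i, (a i : ℕ) + 1 = N - i := fun i => by
    have := i.2
    simp only [a]; omega
  have hb1 : ∀ i, (b i : ℕ) + 1 = lam.ell i := fun i => by
    have := ell_pos lam i
    simp only [b]; omega
  have ha : StrictAnti a := by
    intro i j hij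
    have h1 := ha1 i
    have h2 := ha1 j
    have h3 : (i : ℕ) < j := hij
    rw [Fin.lt_def]
    omega
  have hb : StrictAnti b := by
    intro i j hij
    have h1 := hb1 i
    have h2 := hb1 j
    have h3 := ell_strictAnti lam hij
    rw [Fin.lt_def]
    omega
  unfold G skewG
  rw [partitionFunction_eq_det x r y s
    (fun j c hc => colW_freeFermion x r y s j c (hq c hc j)) a b ha hb]
  · congr 1
    ext i j
    have hh : ∀ j, hopMatrix (colW x r y s j) L = Matrix.of fun a b : Fin L =>
        hopQ (fun k => s k ^ (-2 : ℤ) * y k) y (x j) (r j ^ (-2 : ℤ) * x j)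
          ((a : ℕ) + 1) ((b : ℕ) + 1) := by
      intro j
      ext a b
      exact hop_colW x r y s j _ _
    simp only [hh]
    rw [Matrix.submatrix_apply, ofFn_prod_eq_pathWeight L M (fun j =>
      hopQ (fun k => s k ^ (-2 : ℤ) * y k) y (x j) (r j ^ (-2 : ℤ) * x j)), ha1, hb1]
    rfl
  · unfold Signature.pts Signature.ell Signature.zero
    simp only [ha1, zero_add]
  · unfold Signature.pts
    simp only [hb1]

theorem det_pathWeight {q : ℕ → ℂ} {u : Fin M → ℂ} (hN : 0 < N) (hu : Function.Injective u)
    (hx : Function.Injective x)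
    (hqx : ∀ c ∈ Finset.Icc 1 (lam.parts ⟨0, hN⟩ + N), ∀ j, q c - x j ≠ 0)
    (hqu : ∀ c ∈ Finset.Icc 1 N, ∀ j, q c - u j ≠ 0) :
    (Matrix.of fun i j : Fin N => pathWeight (lam.parts ⟨0, hN⟩ + N) M
      (fun j => hopQ q y (x j) (u j)) (N - i) (lam.ell j)).det =
      (∏ j : Fin M, ∏ k ∈ Finset.Icc 1 N, (q k - u j) / (q k - x j)) *
      ((∏ m, (-1 : ℂ) ^ (N - lam.mu m)) *
        (Matrix.of fun m h => hookSum q y N u x (lam.mu m) (lam.ellTop h)).det) := by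
  set L := lam.parts ⟨0, hN⟩ + N with hL
  let pw := pathWeight L M (fun j => hopQ q y (x j) (u j))
  have ht : ∀ j : Fin M, ∀ a b, b < a → hopQ q y (x j) (u j) a b = 0 :=
    fun j a b h => hopQ_of_lt h
  -- The block A is factored out: a column with ℓ_j ≤ N is a column of A itself, hence the unit
  -- vector; any other column is A times a column of H.
  have hfac : (Matrix.of fun i j : Fin N => pw (N - i) (lam.ell j)) =
      (Matrix.of fun i c : Fin N => pw (N - i) (N - c)) *
      (Matrix.of fun c j : Fin N => if lam.ell j ≤ N then
        (if N - (c : ℕ) = lam.ell j then (1 : ℂ) else 0)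
        else hookSum q y N u x (N - c) (lam.ell j)) := by
    ext i j
    have hi : N - (i : ℕ) ∈ Finset.Icc 1 N := Finset.mem_Icc.mpr (by omega)
    have h1 := ell_pos lam j
    have h2 := ell_le lam hN j
    simp only [Matrix.mul_apply, Matrix.of_apply]
    rw [sum_fin_sub_eq_sum_Icc (fun c => pw (N - i) c * if lam.ell j ≤ N then
        (if c = lam.ell j then (1 : ℂ) else 0) else hookSum q y N u x c (lam.ell j))]
    by_cases hj : lam.ell j ≤ N
    · simp only [if_pos hj]
      rw [Finset.sum_eq_single (lam.ell j)]
      · simp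
      · intro c _ hc
        simp [hc]
      · intro hc
        exact absurd (Finset.mem_Icc.mpr ⟨h1, hj⟩) hc
    · simp only [if_neg hj]
      exact pathWeight_eq_sum_hookSum (by omega) u x hu hx hqx hqu hi
        (Finset.mem_Ioc.mpr (by omega))
  have htri : (Matrix.of fun i c : Fin N => pw (N - i) (N - c)).det =
      ∏ j : Fin M, ∏ k ∈ Finset.Icc 1 N, (q k - u j) / (q k - x j) := by
    -- Paths only move right; with the columns listed in decreasing order the matrix is lower
    -- triangular.
    rw [Matrix.det_of_isLowerTriangular]
    · have h1 : ∀ i : Fin N, (Matrix.of fun i c : Fin N => pw (N - i) (N - c)) i i =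
          ∏ j : Fin M, hopQ q y (x j) (u j) (N - i) (N - i) := fun i =>
        pathWeight_self _ ht (Finset.mem_Icc.mpr (by omega))
      rw [Finset.prod_congr rfl fun i _ => h1 i, Finset.prod_comm]
      refine Finset.prod_congr rfl fun j _ => ?_
      rw [prod_fin_eq_prod_Icc (fun k => hopQ q y (x j) (u j) k k)]
      exact Finset.prod_congr rfl fun k _ => hopQ_self
    · intro i c hic
      have hic' : (i : ℕ) < c := hic
      have := c.2
      exact pathWeight_of_lt _ ht (by omega)
  change (Matrix.of fun i j : Fin N => pw (N - i) (lam.ell j)).det = _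
  rw [hfac, Matrix.det_mul, htri, det_reduction lam (hookSum q y N u x)]

end

theorem theorem3p8 (M N : ℕ) (hM : 0 < M) (hN : 0 < N)
    (x r : Fin M → ℂ) (y s : ℕ → ℂ) (lam : Signature N)
    (hr : ∀ j, r j ≠ 0)
    (hs : ∀ k ∈ Finset.Icc 1 (lam.parts ⟨0, hN⟩ + N), s k ≠ 0)
    (hx : ∀ i j, i ≠ j → x i - x j ≠ 0)
    (hrx : ∀ i j, i ≠ j → r i ^ (-2 : ℤ) * x i - r j ^ (-2 : ℤ) * x j ≠ 0)
    (hyx : ∀ k ∈ Finset.Icc 1 (lam.parts ⟨0, hN⟩ + N), ∀ j, y k - s k ^ 2 * x j ≠ 0)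
    (hyrx : ∀ k ∈ Finset.Icc 1 N, ∀ j, y k - s k ^ 2 * r j ^ (-2 : ℤ) * x j ≠ 0) :
    G lam x y r s =
      (∏ j : Fin M, ∏ k ∈ Finset.Icc 1 N,
        (y k - s k ^ 2 * r j ^ (-2 : ℤ) * x j) / (y k - s k ^ 2 * x j)) *
      ∑ I : {I : Finset (Fin M) // I.card = lam.durfee},
      ∑ J : {J : Finset (Fin M) // J.card = lam.durfee},
        (∏ i ∈ J.1ᶜ, ∏ j ∈ J.1, 1 / (x i - x j)) *
        (∏ i ∈ J.1, ∏ j ∈ J.1 with i < j, 1 / (x j - x i)) *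
        (∏ i ∈ I.1, ∏ j : Fin M, (r i ^ (-2 : ℤ) * x i - x j)) *
        (∏ i ∈ I.1ᶜ, ∏ j ∈ J.1, (r i ^ (-2 : ℤ) * x i - x j)) *
        (∏ i ∈ I.1, ∏ j ∈ I.1ᶜ, 1 / (r i ^ (-2 : ℤ) * x i - r j ^ (-2 : ℤ) * x j)) *
        (∏ i ∈ I.1, ∏ j ∈ I.1 with i < j, 1 / (r i ^ (-2 : ℤ) * x i - r j ^ (-2 : ℤ) * x j)) *
        ∑ σ : Equiv.Perm (Fin lam.durfee), ∑ ρ : Equiv.Perm (Fin lam.durfee),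
          ((Equiv.Perm.sign (σ * ρ) : ℤ) : ℂ) *
          (∏ h : Fin lam.durfee,
            (y (lam.ellTop h) * (1 - s (lam.ellTop h) ^ 2) /
                (y (lam.ellTop h) - s (lam.ellTop h) ^ 2 * x (nth J (ρ h))) *
              ∏ i ∈ Finset.Icc (N + 1) (lam.ellTop h - 1),
                s i ^ 2 * (y i - x (nth J (ρ h))) / (y i - s i ^ 2 * x (nth J (ρ h))))) *
          (∏ m : Fin lam.durfee,
            (s (lam.mu m) ^ 2 /
                (y (lam.mu m) - s (lam.mu m) ^ 2 *
                  r (nth I (σ m)) ^ (-2 : ℤ) * x (nth I (σ m))) *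
              ∏ k ∈ Finset.Icc (lam.mu m + 1) N,
                s k ^ 2 * (r (nth I (σ m)) ^ (-2 : ℤ) * x (nth I (σ m)) - y k) /
                  (y k - s k ^ 2 * r (nth I (σ m)) ^ (-2 : ℤ) * x (nth I (σ m)))))
    ∧ (M < lam.durfee → G lam x y r s = 0) := by
  have hxi : Function.Injective x := fun i j h => by
    by_contra hij
    exact hx i j hij (sub_eq_zero.mpr h)
  let u : Fin M → ℂ := fun j => r j ^ (-2 : ℤ) * x j
  let q : ℕ → ℂ := fun k => s k ^ (-2 : ℤ) * y k
  have hui : Function.Injective u := fun i j h => by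
    by_contra hij
    exact hrx i j hij (sub_eq_zero.mpr h)
  have hsN : ∀ k ∈ Finset.Icc 1 N, s k ≠ 0 := fun k hk =>
    hs k (by simp only [Finset.mem_Icc] at *; omega)
  have hqx : ∀ k ∈ Finset.Icc 1 (lam.parts ⟨0, hN⟩ + N), ∀ j, q k - x j ≠ 0 := by
    intro k hk j
    rw [zpow_neg_two_mul_sub (hs k hk)]
    exact div_ne_zero (hyx k hk j) (pow_ne_zero 2 (hs k hk))
  have hqu : ∀ k ∈ Finset.Icc 1 N, ∀ j, q k - u j ≠ 0 := by
    intro k hk j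
    rw [zpow_neg_two_mul_sub (hsN k hk)]
    refine div_ne_zero ?_ (pow_ne_zero 2 (hsN k hk))
    rw [← mul_assoc]
    exact hyrx k hk j
  have hmain := (G_eq_det (r := r) lam hN hqx).trans
    (det_pathWeight (y := y) lam hN hui hxi hqx hqu)
  rw [det_hookSum] at hmain
  have hpre : (∏ j : Fin M, ∏ k ∈ Finset.Icc 1 N, (q k - u j) / (q k - x j)) =
      ∏ j : Fin M, ∏ k ∈ Finset.Icc 1 N,
        (y k - s k ^ 2 * r j ^ (-2 : ℤ) * x j) / (y k - s k ^ 2 * x j) := by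
    refine Finset.prod_congr rfl fun j _ => Finset.prod_congr rfl fun k hk => ?_
    rw [zpow_neg_two_mul_sub (hsN k hk), zpow_neg_two_mul_sub (hsN k hk),
      div_div_div_cancel_right₀ (pow_ne_zero 2 (hsN k hk)), ← mul_assoc]
  -- The target formula has r⁻²x - y_k where `crossing` has the opposite difference. The resulting N
  -- - μ_m signs are exactly those produced by `det_reduction`.
  have hbeta : ∀ (m : Fin lam.durfee) (i : Fin M), s (lam.mu m) ^ 2 /
      (y (lam.mu m) - s (lam.mu m) ^ 2 * r i ^ (-2 : ℤ) * x i) *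
        ∏ k ∈ Finset.Icc (lam.mu m + 1) N, s k ^ 2 * (r i ^ (-2 : ℤ) * x i - y k) /
          (y k - s k ^ 2 * r i ^ (-2 : ℤ) * x i) =
      (-1) ^ (N - lam.mu m) * betaVec q y N (lam.mu m) (u i) := by
    intro m i
    have hmu := ((mem_muSet_iff lam _).mp (mu_mem lam m)).1
    have hmu' := Finset.mem_Icc.mp hmu
    have e1 : Finset.Icc (lam.mu m + 1) N = Finset.Ioc (lam.mu m) N := by
      ext k; simp only [Finset.mem_Icc, Finset.mem_Ioc]; omega
    have e2 : ∀ k ∈ Finset.Ioc (lam.mu m) N, s k ^ 2 * (r i ^ (-2 : ℤ) * x i - y k) /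
          (y k - s k ^ 2 * r i ^ (-2 : ℤ) * x i) = -crossing q y (u i) k := by
      intro k hk
      have hk' : k ∈ Finset.Icc 1 N := by
        simp only [Finset.mem_Icc, Finset.mem_Ioc] at *; omega
      have h1 := pow_ne_zero 2 (hsN k hk')
      have h2 := hyrx k hk' i
      rw [mul_assoc] at h2
      unfold crossing
      rw [zpow_neg_two_mul_sub (hsN k hk'), mul_assoc (s k ^ 2)]
      simp only [u]
      field_simp
      ring
    have h1 := pow_ne_zero 2 (hsN _ hmu)
    unfold betaVec
    rw [e1, Finset.prod_congr rfl e2, Finset.prod_neg, Nat.card_Ioc,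
      zpow_neg_two_mul_sub (hsN _ hmu), mul_assoc (s (lam.mu m) ^ 2), one_div_div]
    ring
  have hphi : ∀ (h : Fin lam.durfee) (j : Fin M), y (lam.ellTop h) * (1 - s (lam.ellTop h) ^ 2) /
      (y (lam.ellTop h) - s (lam.ellTop h) ^ 2 * x j) *
        ∏ i ∈ Finset.Icc (N + 1) (lam.ellTop h - 1),
          s i ^ 2 * (y i - x j) / (y i - s i ^ 2 * x j) =
      phiVec q y N (lam.ellTop h) (x j) := by
    intro h j
    have hl1 := ell_pos lam (Fin.castLE lam.durfee_le h)
    have hl2 := ell_le lam hN (Fin.castLE lam.durfee_le h)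
    change 1 ≤ lam.ellTop h at hl1
    change lam.ellTop h ≤ _ at hl2
    have hl : lam.ellTop h ∈ Finset.Icc 1 (lam.parts ⟨0, hN⟩ + N) :=
      Finset.mem_Icc.mpr ⟨hl1, hl2⟩
    have e1 : Finset.Icc (N + 1) (lam.ellTop h - 1) = Finset.Ioo N (lam.ellTop h) := by
      ext k; simp only [Finset.mem_Icc, Finset.mem_Ioo]; omega
    unfold phiVec
    rw [e1]
    congr 1
    · have h1 := pow_ne_zero 2 (hs _ hl)
      rw [zpow_neg_two_mul_sub (hs _ hl), zpow_neg_two_mul_sub (hs _ hl),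
        div_div_div_cancel_right₀ h1]
      ring
    · refine Finset.prod_congr rfl fun k hk => ?_
      have hk' : k ∈ Finset.Icc 1 (lam.parts ⟨0, hN⟩ + N) := by
        simp only [Finset.mem_Icc, Finset.mem_Ioo] at *; omega
      have h1 := pow_ne_zero 2 (hs k hk')
      unfold crossing
      rw [zpow_neg_two_mul_sub (hs k hk'), div_div_eq_mul_div]
      ring
  have hG : G lam x y r s = _ := hmain
  refine ⟨?_, fun hd => ?_⟩
  · rw [hG, hpre]
    congr 1
    rw [Finset.mul_sum]
    refine Finset.sum_congr rfl fun I _ => ?_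
    rw [Finset.mul_sum]
    refine Finset.sum_congr rfl fun J _ => ?_
    rw [det_hookCoeff u x hui hxi I J, mul_left_comm]
    congr 1
    rw [Finset.sum_mul_sum, Finset.mul_sum]
    refine Finset.sum_congr rfl fun σ _ => ?_
    rw [Finset.mul_sum]
    refine Finset.sum_congr rfl fun ρ _ => ?_
    simp only [hbeta, hphi, Finset.prod_mul_distrib, Equiv.Perm.sign_mul, Units.val_mul,
      Int.cast_mul]
    change _ * (_ * (∏ m, betaVec q y N (lam.mu m) (u (nth I (σ m)))) *
      (_ * ∏ h, phiVec q y N (lam.ellTop h) (x (nth J (ρ h))))) = _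
    ring
  -- For d > M there are no index sets of size d, so the sum is empty.
  · rw [hG]
    have : IsEmpty {I : Finset (Fin M) // I.card = lam.durfee} := ⟨fun I => by
      have := Finset.card_le_univ I.1
      rw [I.2, Fintype.card_fin] at this
      omega⟩
    simp
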